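/- **Theorem 1.5.** All groups are finite, and classes of groups are closed under isomorphism. A *Fitting class* is a class of groups closed under normal subgroups and under products of two normal subgroups belonging to the class (the empty class is allowed). For a non-empty Fitting class $\mathfrak F$, $G_{\mathfrak F}$ denotes the $\mathfrak F$-radical (the largest normal $\mathfrak F$-subgroup) of $G$; $\mathfrak F\mathfrak K$ is the class of all $G$ with $G/G_{\mathfrak F}\in\mathfrak K$. A subgroup $V$ of $G$ is $\mathfrak F$-maximal in $G$ if $V\in\mathfrak F$ and $V\le U\le G$, $U\in\mathfrak F$ imply $U=V$; $V$ is an $\mathfrak F$-injector of $G$ if $V\cap K$ is $\mathfrak F$-maximal in $K$ for every subnormal subgroup $K$ of $G$. For a set $\pi$ of primes with complement $\pi'$ in the set of all primes, $\mathfrak E_\pi$, $\mathfrak N_\pi$ and $\mathfrak S^\pi$ denote the classes of all $\pi$-groups, all nilpotent $\pi$-groups and all $\pi$-soluble groups, where $G$ is $\pi$-soluble if it has a series $1=G_0\trianglelefteq G_1\trianglelefteq\dots\trianglelefteq G_m=G$ each factor of which is a $p$-group for some $p\in\pi$ or a $\pi'$-group; $\mathfrak E_{p'}=\mathfrak E_{\{p\}'}$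 and $\mathfrak N_p=\mathfrak N_{\{p\}}$. A Hall $\pi$-subgroup is a $\pi$-subgroup whose index is divisible by no prime in $\pi$. Let $h$ be a function assigning to each prime a (possibly empty) Fitting class, let $\pi=\operatorname{Supp}(h)=\{p : h(p)\ne\emptyset\}$, and suppose that $h$ is invariable, that is, there is a non-empty Fitting class $\mathfrak X$ with $h(p)=\mathfrak X$ for all $p\in\pi$. Let $$\mathfrak H=LH(h)=\bigcap_{p\in\pi}h(p)\,\mathfrak E_{p'}\mathfrak N_p=\bigcap_{p\in\pi}\mathfrak X\mathfrak E_{p'}\mathfrak N_p$$ be the Hartley class defined by $h$ (the class of all groups if $\pi=\emptyset$). Let $G\in\mathfrak X\mathfrak S^\pi$; this holds in particular for every $\pi$-soluble group $G$. Then: 1. $G$ possesses an $\mathfrak H$-injector, and any two $\mathfrak H$-injectors of $G$ are conjugate in $G$. 2. Every $\mathfrak H$-injector $V$ of $G$ is of the form $V=G_{\mathfrak X\mathfrak E_{\pi'}}L$, where $L$ is a subgroup of $G$ containing $G_{\mathfrak X}$ such that $L/G_{\mathfrak X}$ is an $\mathfrak N_\pi$-injector of some Hall $\pi$-subgroup of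 $G/G_{\mathfrak X}$. -/

import Mathlib

open scoped Pointwise

universe u

/-- A class of finite groups, given by its membership predicate. Closure under isomorphism is
part of `IsFittingClass`; all concrete classes below are visibly closed under isomorphism. -/
abbrev GroupClass := (G : Type u) → [Group G] → [Finite G] → Prop

namespace GroupClass

/-- The class contains at least one group. -/
def Nonempty (F : GroupClass.{u}) : Prop :=
  ∃ (G : Type u) (_ : Group G) (_ : Finite G), F G

end GroupClass

/-- A Fitting class: an isomorphism-closed class of finite groups which is closed under normal
subgroups and under products of two normal subgroups belonging to the class
(for normal `M`, `N` the join `M ⊔ N` is the product `MN`). The empty class is allowed. -/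
structure IsFittingClass (F : GroupClass.{u}) : Prop where
  iso : ∀ (G H : Type u) [Group G] [Finite G] [Group H] [Finite H], G ≃* H → F G → F H
  normal : ∀ (G : Type u) [Group G] [Finite G] (N : Subgroup G), N.Normal → F G → F N
  sup : ∀ (G : Type u) [Group G] [Finite G] (M N : Subgroup G), M.Normal → N.Normal →
    F M → F N → F (M ⊔ N : Subgroup G)

/-- The `F`-radical of `G`: the subgroup generated by all normal `F`-subgroups of `G`. For a
non-empty Fitting class it is the largest normal `F`-subgroup of `G`. -/
def radical (F : GroupClass.{u}) (G : Type u) [Group G] [Finite G] : Subgroup G :=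
  sSup {N : Subgroup G | N.Normal ∧ F N}

instance radical_normal (F : GroupClass.{u}) (G : Type u) [Group G] [Finite G] :
    (radical F G).Normal := by
  refine ⟨fun n hn g => ?_⟩
  have key : radical F G ≤ (radical F G).comap (MulAut.conj g).toMonoidHom := by
    refine sSup_le fun N hN x hx => ?_
    have hle : N ≤ radical F G := le_sSup hN
    exact hle (hN.1.conj_mem x hx g)
  exact key hn

/-- The product of two classes: all `G` with `G / G_F` in `H`. -/
def classMul (F H : GroupClass.{u}) : GroupClass.{u} :=
  fun G _ _ => H (G ⧸ radical F G)

/-- All primes dividing the order of `G` lie in `π`. -/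
def IsPiGroup (π : Set Nat.Primes) (G : Type u) [Group G] : Prop :=
  ∀ p : Nat.Primes, (p : ℕ) ∣ Nat.card G → p ∈ π

/-- The class of all finite `π`-groups. -/
def piGroups (π : Set Nat.Primes) : GroupClass.{u} :=
  fun G _ _ => IsPiGroup π G

/-- The class of all finite nilpotent `π`-groups. -/
def nilpotentPiGroups (π : Set Nat.Primes) : GroupClass.{u} :=
  fun G _ _ => Group.IsNilpotent G ∧ IsPiGroup π G

/-- The class of all finite `p`-groups. -/
def pGroups (p : Nat.Primes) : GroupClass.{u} :=
  fun G _ _ => IsPGroup p G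

/-- The class of all finite `π`-soluble groups: groups with a series
`1 = S 0 ⊴ S 1 ⊴ ⋯ ⊴ S m = G`, each factor of which is a `p`-group for some `p ∈ π`
or a `π'`-group. -/
def piSolubleGroups (π : Set Nat.Primes) : GroupClass.{u} :=
  fun G _ _ => ∃ (m : ℕ) (S : ℕ → Subgroup G), S 0 = ⊥ ∧ S m = ⊤ ∧
    ∀ i < m, S i ≤ S (i + 1) ∧
      ∃ _ : ((S i).subgroupOf (S (i + 1))).Normal,
        (∃ p ∈ π, IsPGroup (p : Nat.Primes) (S (i + 1) ⧸ (S i).subgroupOf (S (i + 1)))) ∨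
          IsPiGroup πᶜ (S (i + 1) ⧸ (S i).subgroupOf (S (i + 1)))

/-- A Hall `π`-subgroup: a `π`-subgroup whose index is divisible by no prime in `π`. -/
def IsHallSubgroup (π : Set Nat.Primes) {G : Type u} [Group G] (H : Subgroup G) : Prop :=
  IsPiGroup π H ∧ ∀ p : Nat.Primes, (p : ℕ) ∣ H.index → p ∉ π

/-- `V` is an `F`-maximal subgroup of `G`. -/
def IsMaximalIn (F : GroupClass.{u}) {G : Type u} [Group G] [Finite G] (V : Subgroup G) : Prop :=
  F V ∧ ∀ U : Subgroup G, V ≤ U → F U → U = V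

/-- `V` is an `F`-injector of `G`: for every subnormal subgroup `K` of `G`, the intersection
`V ∩ K`, viewed as a subgroup of `K`, is `F`-maximal in `K`. -/
def IsInjector (F : GroupClass.{u}) {G : Type u} [Group G] [Finite G] (V : Subgroup G) : Prop :=
  ∀ K : Subgroup G, K.IsSubnormal → IsMaximalIn F (V.subgroupOf K)

/-- An `H`-function: it assigns to each prime a Fitting class, possibly the empty one. -/
structure HFunction where
  toFun : Nat.Primes → GroupClass.{u}
  isFittingClass : ∀ p, IsFittingClass (toFun p)

/-- The support of an `H`-function: the primes with a non-empty value. -/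
def HFunction.supp (h : HFunction.{u}) : Set Nat.Primes :=
  {p | (h.toFun p).Nonempty}

/-- The Hartley class `LH(h)`: the intersection over `p` in the support of `h` of the classes
`h(p) 𝔈_{p'} 𝔑_p` (all finite groups, if the support is empty). -/
def hartleyClass (h : HFunction.{u}) : GroupClass.{u} :=
  fun G _ _ => ∀ p ∈ h.supp, classMul (classMul (h.toFun p) (piGroups {p}ᶜ)) (pGroups p) G

/-! Write `Y` for the class `X 𝔈_{π'}`. A finite group is `p`-nilpotent for every `p ∈ π` exactly
when it is an extension of a `π'`-group by a nilpotent `π`-group, so associativity of class products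
turns the Hartley class into `Y 𝔑_π` (`hartleyClass_eq`). Since `Y 𝔈_{π'} = Y`, the `π`-soluble
group `G / G_Y` has no nontrivial normal `π'`-subgroup, and its largest normal nilpotent
`π`-subgroup `F` contains its own centralizer (`isSelfCentralizing_radical`).

The core of the proof describes the maximal nilpotent `π`-subgroups above such an `F`. For `p ∈ π`
let `C_p` be the centralizer of the `p'`-part of `F` (`pCent`). For `p ≠ q` the intersection of
`C_p` and `C_q` centralizes `F`, hence lies in `F`, and this forces `C_p` to normalize every Sylow
`q`-subgroup of `C_q` (`conj_mem_of_mem_pCent`). Sylow `p`-subgroups of the `C_p`, one for each `p ∈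
π`, therefore commute elementwise, and their products are exactly the maximal nilpotent
`π`-subgroups containing `F` (`isMaximalIn_iSup`, `isSylowIn_relCore`). Conjugacy is Sylow's theorem
applied one prime at a time (`exists_conj`). Compatibility with subnormal subgroups is a coprime
action argument (`commute_of_commute_inf_subnormal`, `le_of_inf_subnormal_le`).

Every subgroup of `G` above the `Y 𝔑_π`-radical has `Y`-radical `G_Y` (`relRadical_eq`), so the
injectors of `G` are the preimages of these products (`isInjector_iff`). For their structure, a Hall
`π`-subgroup of `G / G_X` embeds into `G / G_Y` with `π'`-index; a suitable conjugate of it covers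
`V / G_Y`, and pulling back yields `L` (`exists_structure_of_isInjector`). -/

/-! ### `σ`-numbers and `σ`-groups -/

/-- A nonzero natural number all of whose prime divisors lie in `σ`. -/
def IsPiNat (σ : Set Nat.Primes) (n : ℕ) : Prop :=
  n ≠ 0 ∧ ∀ p : Nat.Primes, (p : ℕ) ∣ n → p ∈ σ

namespace IsPiNat

variable {σ τ : Set Nat.Primes} {m n : ℕ}

theorem one : IsPiNat σ 1 :=
  ⟨one_ne_zero, fun p hp => absurd (Nat.dvd_one.1 hp) p.2.ne_one⟩

theorem mul (hm : IsPiNat σ m) (hn : IsPiNat σ n) : IsPiNat σ (m * n) :=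
  ⟨mul_ne_zero hm.1 hn.1, fun p hp => (p.2.dvd_mul.1 hp).elim (hm.2 p) (hn.2 p)⟩

theorem of_dvd (hn : IsPiNat σ n) (h : m ∣ n) : IsPiNat σ m :=
  ⟨fun h0 => hn.1 (Nat.eq_zero_of_zero_dvd (h0 ▸ h)), fun p hp => hn.2 p (hp.trans h)⟩

theorem mono (hn : IsPiNat σ n) (h : σ ⊆ τ) : IsPiNat τ n :=
  ⟨hn.1, fun p hp => h (hn.2 p hp)⟩

theorem coprime (hm : IsPiNat σ m) (hn : IsPiNat τ n) (h : Disjoint σ τ) : Nat.Coprime m n :=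
  Nat.Coprime.symm <| Nat.coprime_of_dvd fun p hp hpn hpm =>
    Set.disjoint_left.1 h (hm.2 ⟨p, hp⟩ hpm) (hn.2 ⟨p, hp⟩ hpn)

theorem eq_prime_pow {p : Nat.Primes} (hn : IsPiNat {p} n) : ∃ k, n = (p : ℕ) ^ k :=
  ⟨_, Nat.eq_prime_pow_of_unique_prime_dvd hn.1 fun {d} hd hdn =>
    congrArg Subtype.val (Set.mem_singleton_iff.1 (hn.2 ⟨d, hd⟩ hdn))⟩

theorem prime_pow (p : Nat.Primes) (hp : p ∈ σ) (k : ℕ) : IsPiNat σ ((p : ℕ) ^ k) :=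
  ⟨pow_ne_zero _ p.2.ne_zero, fun q hq => by
    have : q = p := Subtype.ext ((Nat.prime_dvd_prime_iff_eq q.2 p.2).1 (q.2.dvd_of_dvd_pow hq))
    exact this ▸ hp⟩

/-- Every nonzero number is the product of a `σ`-number and a `σᶜ`-number. -/
theorem exists_mul (σ : Set Nat.Primes) (hn : n ≠ 0) :
    ∃ a b, IsPiNat σ a ∧ IsPiNat σᶜ b ∧ n = a * b := by
  induction n using Nat.recOnMul with
  | zero => exact absurd rfl hn
  | one => exact ⟨1, 1, one, one, rfl⟩
  | prime p hp =>
    by_cases h : (⟨p, hp⟩ : Nat.Primes) ∈ σ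
    · exact ⟨p, 1, by simpa using prime_pow ⟨p, hp⟩ h 1, one, by simp⟩
    · exact ⟨1, p, one, by simpa using prime_pow (σ := σᶜ) ⟨p, hp⟩ h 1, by simp⟩
  | mul a b iha ihb =>
    obtain ⟨a1, a2, h1, h2, rfl⟩ := iha (left_ne_zero_of_mul hn)
    obtain ⟨b1, b2, h3, h4, rfl⟩ := ihb (right_ne_zero_of_mul hn)
    exact ⟨a1 * b1, a2 * b2, h1.mul h3, h2.mul h4, by ring⟩

end IsPiNat

/-- An element is in a subgroup as soon as two coprime powers of it are. -/
theorem mem_of_pow_mem_of_coprime {G : Type*} [Group G] {H : Subgroup G} {x : G} {m n : ℕ}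
    (h : Nat.Coprime m n) (hm : x ^ m ∈ H) (hn : x ^ n ∈ H) : x ∈ H := by
  have := Nat.gcd_eq_gcd_ab m n
  rw [h] at this
  have hx : x = (x ^ m) ^ (m.gcdA n) * (x ^ n) ^ (m.gcdB n) := by
    rw [← zpow_natCast x m, ← zpow_natCast x n, ← zpow_mul, ← zpow_mul, ← zpow_add, ← this]
    simp
  rw [hx]
  exact H.mul_mem (H.zpow_mem hm _) (H.zpow_mem hn _)

section PiGroup

variable {σ τ : Set Nat.Primes} {G : Type*} [Group G]

theorem isPiGroup_iff_card [Finite G] : IsPiGroup σ G ↔ IsPiNat σ (Nat.card G) :=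
  ⟨fun h => ⟨Nat.card_pos.ne', h⟩, fun h => h.2⟩

/-- The converse is Cauchy's theorem. As any `σ`-number may serve as exponent, extensions of
`σ`-groups are handled by multiplying exponents. -/
theorem isPiGroup_iff [Finite G] : IsPiGroup σ G ↔ ∀ x : G, ∃ n, IsPiNat σ n ∧ x ^ n = 1 := by
  constructor
  · exact fun h x => ⟨_, isPiGroup_iff_card.1 h, pow_card_eq_one'⟩
  · intro h p hp
    have : Fact (p : ℕ).Prime := ⟨p.2⟩
    obtain ⟨x, hx⟩ := exists_prime_orderOf_dvd_card' (p : ℕ) hp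
    obtain ⟨n, hn, hxn⟩ := h x
    exact hn.2 p (hx ▸ orderOf_dvd_of_pow_eq_one hxn)

theorem IsPiGroup.mono (h : IsPiGroup σ G) (hστ : σ ⊆ τ) : IsPiGroup τ G :=
  fun p hp => hστ (h p hp)

theorem IsPiGroup.of_injective [Finite G] {H : Type*} [Group H] (h : IsPiGroup σ G)
    (f : H →* G) (hf : Function.Injective f) : IsPiGroup σ H :=
  fun p hp => h p (hp.trans (Subgroup.card_dvd_of_injective f hf))

theorem IsPiGroup.of_surjective [Finite G] {H : Type*} [Group H] (h : IsPiGroup σ G)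
    (f : G →* H) (hf : Function.Surjective f) : IsPiGroup σ H :=
  fun p hp => h p (hp.trans (Subgroup.card_dvd_of_surjective f hf))

theorem IsPiGroup.to_le [Finite G] {H K : Subgroup G} (h : IsPiGroup σ K) (hle : H ≤ K) :
    IsPiGroup σ H :=
  h.of_injective (Subgroup.inclusion hle) (Subgroup.inclusion_injective hle)

theorem IsPiGroup.to_subgroup [Finite G] (h : IsPiGroup σ G) (H : Subgroup G) : IsPiGroup σ H :=
  h.of_injective H.subtype H.subtype_injective

theorem IsPiGroup.map [Finite G] {G' : Type*} [Group G'] {H : Subgroup G} (h : IsPiGroup σ H)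
    (f : G →* G') : IsPiGroup σ (H.map f) :=
  h.of_surjective (f.subgroupMap H) (f.subgroupMap_surjective H)

theorem isPiGroup_subgroup_iff [Finite G] {H : Subgroup G} :
    IsPiGroup σ H ↔ ∀ x ∈ H, ∃ n, IsPiNat σ n ∧ x ^ n = 1 := by
  rw [isPiGroup_iff]
  exact ⟨fun h x hx => (h ⟨x, hx⟩).imp fun n hn => ⟨hn.1, congrArg Subtype.val hn.2⟩,
    fun h x => (h x x.2).imp fun n hn => ⟨hn.1, Subtype.ext hn.2⟩⟩

theorem isPiGroup_quotient_iff [Finite G] {N : Subgroup G} [N.Normal] :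
    IsPiGroup σ (G ⧸ N) ↔ ∀ x : G, ∃ n, IsPiNat σ n ∧ x ^ n ∈ N := by
  rw [isPiGroup_iff]
  constructor
  · intro h x
    obtain ⟨n, hn, hx⟩ := h x
    exact ⟨n, hn, (QuotientGroup.eq_one_iff _).1 hx⟩
  · intro h x
    obtain ⟨x, rfl⟩ := QuotientGroup.mk_surjective x
    obtain ⟨n, hn, hx⟩ := h x
    exact ⟨n, hn, (QuotientGroup.eq_one_iff (x ^ n)).2 hx⟩

theorem isPiGroup_singleton_iff [Finite G] {p : Nat.Primes} : IsPiGroup {p} G ↔ IsPGroup p G := by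
  rw [isPiGroup_iff]
  constructor
  · intro h x
    obtain ⟨n, hn, hx⟩ := h x
    obtain ⟨k, rfl⟩ := hn.eq_prime_pow
    exact ⟨k, hx⟩
  · intro h x
    obtain ⟨k, hk⟩ := h x
    exact ⟨_, .prime_pow p (Set.mem_singleton p) k, hk⟩

theorem IsPiGroup.of_subsingleton [Subsingleton G] : IsPiGroup σ G := fun p hp => by
  rw [Nat.card_unique] at hp
  exact absurd (Nat.dvd_one.1 hp) p.2.ne_one

theorem IsPiGroup.eq_bot_of_compl [Finite G] {H : Subgroup G} (h : IsPiGroup σ H)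
    (h' : IsPiGroup σᶜ H) : H = ⊥ := by
  refine (Subgroup.eq_bot_iff_forall _).2 fun x hx => ?_
  obtain ⟨m, hm, hxm⟩ := isPiGroup_subgroup_iff.1 h x hx
  obtain ⟨n, hn, hxn⟩ := isPiGroup_subgroup_iff.1 h' x hx
  exact mem_of_pow_mem_of_coprime (H := ⊥) (hm.coprime hn disjoint_compl_right) hxm hxn

/-- The product of a `σ`-subgroup with a normal `σ`-subgroup is a `σ`-group. -/
theorem IsPiGroup.sup [Finite G] {M N : Subgroup G} [N.Normal] (hM : IsPiGroup σ M)
    (hN : IsPiGroup σ N) : IsPiGroup σ (M ⊔ N : Subgroup G) := by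
  refine isPiGroup_subgroup_iff.2 fun x hx => ?_
  have hx' : (x : G ⧸ N) ∈ M.map (QuotientGroup.mk' N) := by
    have := Subgroup.mem_map_of_mem (QuotientGroup.mk' N) hx
    rwa [Subgroup.map_sup, (Subgroup.map_eq_bot_iff N).2 (by simp), sup_bot_eq] at this
  obtain ⟨m, hm, hxm⟩ := isPiGroup_subgroup_iff.1 (hM.map _) _ hx'
  have : x ^ m ∈ N := (QuotientGroup.eq_one_iff _).1 hxm
  obtain ⟨n, hn, hxn⟩ := isPiGroup_subgroup_iff.1 hN _ this
  exact ⟨m * n, hm.mul hn, by rw [pow_mul, hxn]⟩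

end PiGroup

theorem isFittingClass_piGroups (σ : Set Nat.Primes) : IsFittingClass.{u} (piGroups σ) where
  iso _ _ _ _ _ _ e h := IsPiGroup.of_injective h e.symm.toMonoidHom e.symm.injective
  normal _ _ _ N _ h := IsPiGroup.to_subgroup h N
  sup _ _ _ _ _ _ _ h h' := IsPiGroup.sup h h'

theorem nonempty_piGroups (σ : Set Nat.Primes) : (piGroups.{u} σ).Nonempty :=
  ⟨PUnit, inferInstance, inferInstance, IsPiGroup.of_subsingleton⟩

theorem pGroups_eq_piGroups (p : Nat.Primes) : pGroups.{u} p = piGroups {p} := by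
  funext G _ _
  exact propext isPiGroup_singleton_iff.symm

/-! ### Radicals of Fitting classes -/

section Radical

variable {F : GroupClass.{u}} {G : Type u} [Group G] [Finite G]

theorem IsFittingClass.of_subsingleton (hF : IsFittingClass F) (hne : F.Nonempty)
    [Subsingleton G] : F G := by
  obtain ⟨A, _, _, hA⟩ := hne
  have : Unique G := ⟨⟨1⟩, fun _ => Subsingleton.elim _ _⟩
  exact hF.iso (⊥ : Subgroup A) G MulEquiv.ofUnique (hF.normal A ⊥ inferInstance hA)

theorem IsFittingClass.mem_congr (hF : IsFittingClass F) {H : Type u} [Group H] [Finite H]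
    (e : G ≃* H) : F G ↔ F H :=
  ⟨hF.iso _ _ e, hF.iso _ _ e.symm⟩

theorem le_radical {N : Subgroup G} (hN : N.Normal) (h : F N) : N ≤ radical F G :=
  le_sSup ⟨hN, h⟩

theorem radical_mem (hF : IsFittingClass F) (hne : F.Nonempty) : F (radical F G) := by
  have hfin : {N : Subgroup G | N.Normal ∧ F N}.Finite := Set.toFinite _
  have key : ∀ s : Finset (Subgroup G), (∀ N ∈ s, N.Normal ∧ F N) →
      (s.sup id).Normal ∧ F (s.sup id : Subgroup G) := by
    intro s hs
    refine Finset.sup_induction (p := fun N : Subgroup G => N.Normal ∧ F N)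
      ⟨inferInstance, hF.of_subsingleton hne⟩ ?_ hs
    rintro M ⟨hM, hM'⟩ N ⟨hN, hN'⟩
    exact ⟨Subgroup.sup_normal M N, hF.sup G M N hM hN hM' hN'⟩
  have h := (key hfin.toFinset fun N hN => hfin.mem_toFinset.1 hN).2
  have e : hfin.toFinset.sup id = radical F G := by
    rw [Finset.sup_id_eq_sSup, hfin.coe_toFinset]; rfl
  rwa [e] at h

theorem radical_eq_top (h : F G) (hF : IsFittingClass F) : radical F G = ⊤ :=
  top_le_iff.1 (le_radical inferInstance (hF.iso _ _ Subgroup.topEquiv.symm h))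

theorem radical_map_equiv_le (hF : IsFittingClass F) {H : Type u} [Group H] [Finite H]
    (e : G ≃* H) : (radical F G).map e.toMonoidHom ≤ radical F H := by
  rw [Subgroup.map_le_iff_le_comap]
  refine sSup_le ?_
  rintro N ⟨hN, hN'⟩
  rw [← Subgroup.map_le_iff_le_comap]
  exact le_radical (hN.map _ e.surjective)
    (hF.iso _ _ (N.equivMapOfInjective e.toMonoidHom e.injective) hN')

theorem radical_map_equiv (hF : IsFittingClass F) {H : Type u} [Group H] [Finite H]
    (e : G ≃* H) : (radical F G).map e.toMonoidHom = radical F H := by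
  refine le_antisymm (radical_map_equiv_le hF e) fun x hx => ?_
  exact ⟨e.symm x, radical_map_equiv_le hF e.symm ⟨x, hx, rfl⟩, by simp⟩

theorem radical_characteristic (hF : IsFittingClass F) : (radical F G).Characteristic :=
  Subgroup.characteristic_iff_map_eq.2 fun e => radical_map_equiv hF e

theorem radical_map_subtype_normal (hF : IsFittingClass F) (N : Subgroup G) [N.Normal] :
    ((radical F N).map N.subtype).Normal :=
  have := radical_characteristic (G := N) hF
  inferInstance

theorem IsFittingClass.mem_of_normal_le (hF : IsFittingClass F) {M N : Subgroup G} (h : M ≤ N)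
    (hM : (M.subgroupOf N).Normal) (hN : F N) : F M :=
  hF.iso _ _ (Subgroup.subgroupOfEquivOfLe h) (hF.normal N _ hM hN)

/-- The radical of a normal subgroup is its intersection with the radical. -/
theorem radical_normal_eq (hF : IsFittingClass F) (hne : F.Nonempty) (N : Subgroup G) [N.Normal] :
    radical F N = (radical F G).subgroupOf N := by
  apply le_antisymm
  · have := radical_map_subtype_normal hF N
    rw [Subgroup.subgroupOf, ← Subgroup.map_le_iff_le_comap]
    exact le_radical this (hF.iso _ _
      ((radical F N).equivMapOfInjective _ N.subtype_injective) (radical_mem hF hne))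
  · refine le_radical inferInstance ?_
    have h1 : F (radical F G ⊓ N : Subgroup G) :=
      hF.mem_of_normal_le inf_le_left inferInstance (radical_mem hF hne)
    rw [← Subgroup.inf_subgroupOf_right]
    exact hF.iso _ _ (Subgroup.subgroupOfEquivOfLe inf_le_right).symm h1

/-- The image in `G` of the radical of a subgroup. -/
def relRadical (F : GroupClass.{u}) (H : Subgroup G) : Subgroup G :=
  (radical F H).map H.subtype

theorem relRadical_le (H : Subgroup G) : relRadical F H ≤ H :=
  Subgroup.map_subtype_le _

theorem relRadical_subgroupOf (H : Subgroup G) : (relRadical F H).subgroupOf H = radical F H :=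
  Subgroup.comap_map_eq_self_of_injective H.subtype_injective _

theorem relRadical_eq_self (hF : IsFittingClass F) {H : Subgroup G} (h : F H) :
    relRadical F H = H := by
  rw [relRadical, radical_eq_top h hF, ← MonoidHom.range_eq_map, Subgroup.range_subtype]

theorem relRadical_mem (hF : IsFittingClass F) (hne : F.Nonempty) (H : Subgroup G) :
    F (relRadical F H) :=
  hF.iso _ _ ((radical F H).equivMapOfInjective _ H.subtype_injective) (radical_mem hF hne)

theorem relRadical_subgroupOf_normal (H : Subgroup G) : ((relRadical F H).subgroupOf H).Normal := by
  rw [relRadical_subgroupOf]; infer_instance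

theorem relRadical_top (hF : IsFittingClass F) : relRadical F (⊤ : Subgroup G) = radical F G :=
  radical_map_equiv hF Subgroup.topEquiv

theorem relRadical_normal_le (hF : IsFittingClass F) (hne : F.Nonempty) {M N : Subgroup G}
    (h : M ≤ N) (hM : (M.subgroupOf N).Normal) : relRadical F M = relRadical F N ⊓ M := by
  have h1 := radical_normal_eq hF hne (M.subgroupOf N)
  have h2 := radical_map_equiv hF (Subgroup.subgroupOfEquivOfLe h)
  ext x
  constructor
  · rintro ⟨y, hy, rfl⟩
    refine ⟨?_, y.2⟩
    have hy : y ∈ radical F M := hy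
    rw [← h2] at hy
    obtain ⟨z, hz, rfl⟩ := hy
    have hz : z ∈ radical F (M.subgroupOf N) := hz
    rw [h1] at hz
    exact ⟨z, hz, rfl⟩
  · rintro ⟨⟨y, hy, rfl⟩, hyM⟩
    refine ⟨⟨y, hyM⟩, ?_, rfl⟩
    change _ ∈ radical F M
    rw [← h2]
    refine ⟨⟨y, hyM⟩, ?_, rfl⟩
    change _ ∈ radical F (M.subgroupOf N)
    rw [h1]
    exact hy

theorem relRadical_subnormal (hF : IsFittingClass F) (hne : F.Nonempty) {N : Subgroup G}
    (hN : N.IsSubnormal) : relRadical F N = radical F G ⊓ N := by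
  induction hN with
  | top => rw [relRadical_top hF, inf_top_eq]
  | step H K hle _ hn ih =>
    rw [relRadical_normal_le hF hne hle hn, ih, inf_assoc, inf_eq_right.2 hle]

/-- Intersecting each normal step of the subnormal chain with `V` gives a normal step again. -/
theorem IsFittingClass.subnormal_inf (hF : IsFittingClass F) {V N : Subgroup G} (hV : F V)
    (hN : N.IsSubnormal) : F (V ⊓ N : Subgroup G) := by
  induction hN with
  | top => rwa [inf_top_eq]
  | step H K hle _ hn ih =>
    refine hF.mem_of_normal_le (inf_le_inf_left V hle) ?_ ih
    rw [Subgroup.normal_subgroupOf_iff_le_normalizer hle] at hn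
    rw [Subgroup.normal_subgroupOf_iff_le_normalizer (inf_le_inf_left V hle)]
    refine le_trans (inf_le_inf Subgroup.le_normalizer hn) ?_
    exact Subgroup.inf_normalizer_le_normalizer_inf

end Radical

/-! ### Products of classes -/

section ClassMul

/-- The quotient by the kernel is isomorphic to the range. -/
noncomputable def quotientEquivRange {A B : Type*} [Group A] [Group B] (f : A →* B)
    (N : Subgroup A) [N.Normal] (h : f.ker = N) : A ⧸ N ≃* f.range :=
  (QuotientGroup.quotientMulEquivOfEq h.symm).trans (QuotientGroup.quotientKerEquivRange f)

variable {F H J : GroupClass.{u}} {G : Type u} [Group G] [Finite G]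

theorem classMul_iff_range (hH : IsFittingClass H) {B : Type u} [Group B] [Finite B] (f : G →* B)
    (h : f.ker = radical F G) : classMul F H G ↔ H f.range :=
  hH.mem_congr (quotientEquivRange f _ h)

theorem classMul_iff_of_surjective (hH : IsFittingClass H) {B : Type u} [Group B] [Finite B]
    (f : G →* B) (hf : Function.Surjective f) (h : f.ker = radical F G) :
    classMul F H G ↔ H B := by
  rw [classMul_iff_range hH f h, MonoidHom.range_eq_top.2 hf]
  exact hH.mem_congr Subgroup.topEquiv

/-- The hypothesis makes `U.map f` a copy of `U` modulo its `F`-radical, so membership can be tested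
inside one fixed quotient of `G`. -/
theorem classMul_subgroup_iff (hH : IsFittingClass H) {B : Type u} [Group B] [Finite B]
    (f : G →* B) {U : Subgroup G} (h : f.ker ⊓ U = relRadical F U) :
    classMul F H U ↔ H (U.map f) := by
  have := classMul_iff_range (F := F) hH (f.comp U.subtype) (by
    rw [← relRadical_subgroupOf, ← h, Subgroup.inf_subgroupOf_right]; rfl)
  rw [this, MonoidHom.range_comp, Subgroup.range_subtype]

theorem classMul_subnormal_iff (hF : IsFittingClass F) (hne : F.Nonempty) (hH : IsFittingClass H)
    {N : Subgroup G} (hN : N.IsSubnormal) :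
    classMul F H N ↔ H (N.map (QuotientGroup.mk' (radical F G))) :=
  classMul_subgroup_iff hH _ (by
    rw [QuotientGroup.ker_mk', relRadical_subnormal hF hne hN])

theorem isFittingClass_classMul (hF : IsFittingClass F) (hne : F.Nonempty)
    (hH : IsFittingClass H) : IsFittingClass (classMul F H) where
  iso G K _ _ _ _ e h := by
    refine (classMul_iff_of_surjective hH ((QuotientGroup.mk' (radical F K)).comp e.toMonoidHom)
      ((QuotientGroup.mk'_surjective _).comp e.surjective) ?_).1 h
    rw [← MonoidHom.comap_ker, QuotientGroup.ker_mk', ← radical_map_equiv hF e,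
      Subgroup.comap_map_eq_self_of_injective e.injective]
  normal G _ _ N hN h :=
    (classMul_subnormal_iff hF hne hH hN.isSubnormal).2 <|
      hH.normal _ _ (hN.map _ (QuotientGroup.mk'_surjective _)) h
  sup G _ _ M N hM hN hM' hN' := by
    rw [classMul_subnormal_iff hF hne hH hM.isSubnormal] at hM'
    rw [classMul_subnormal_iff hF hne hH hN.isSubnormal] at hN'
    rw [classMul_subnormal_iff hF hne hH (Subgroup.sup_normal M N).isSubnormal, Subgroup.map_sup]
    exact hH.sup _ _ _ (hM.map _ (QuotientGroup.mk'_surjective _))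
      (hN.map _ (QuotientGroup.mk'_surjective _)) hM' hN'

theorem classMul_nonempty (hH : IsFittingClass H) (hHne : H.Nonempty) : (classMul F H).Nonempty := by
  refine ⟨PUnit, inferInstance, inferInstance, ?_⟩
  have : Subsingleton (PUnit.{u+1} ⧸ radical F PUnit.{u+1}) :=
    Quotient.instSubsingletonQuotient _
  exact hH.of_subsingleton hHne

theorem radical_classMul (hF : IsFittingClass F) (hne : F.Nonempty) (hH : IsFittingClass H)
    (hHne : H.Nonempty) : radical (classMul F H) G =
      (radical H (G ⧸ radical F G)).comap (QuotientGroup.mk' (radical F G)) := by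
  apply le_antisymm
  · rw [← Subgroup.map_le_iff_le_comap]
    refine le_radical ((radical_normal _ _).map _ (QuotientGroup.mk'_surjective _)) ?_
    rw [← classMul_subnormal_iff hF hne hH (radical_normal _ _).isSubnormal]
    exact radical_mem (isFittingClass_classMul hF hne hH) (classMul_nonempty hH hHne)
  · refine le_radical inferInstance ?_
    rw [classMul_subnormal_iff hF hne hH (Subgroup.Normal.isSubnormal inferInstance),
      Subgroup.map_comap_eq_self_of_surjective (QuotientGroup.mk'_surjective _)]
    exact radical_mem hH hHne

theorem radical_le_radical_classMul (hF : IsFittingClass F) (hne : F.Nonempty)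
    (hH : IsFittingClass H) (hHne : H.Nonempty) : radical F G ≤ radical (classMul F H) G := by
  rw [radical_classMul hF hne hH hHne]
  exact QuotientGroup.le_comap_mk' _ _

/-- By `radical_classMul`, the composite of the two successive projections has the radical of the
product class as kernel, so both sides test the same quotient. -/
theorem classMul_assoc (hF : IsFittingClass F) (hne : F.Nonempty) (hH : IsFittingClass H)
    (hHne : H.Nonempty) (hJ : IsFittingClass J) :
    classMul (classMul F H) J = classMul F (classMul H J) := by
  funext G _ _
  refine propext (classMul_iff_of_surjective hJ
    ((QuotientGroup.mk' (radical H (G ⧸ radical F G))).comp (QuotientGroup.mk' (radical F G)))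
    ((QuotientGroup.mk'_surjective _).comp (QuotientGroup.mk'_surjective _)) ?_)
  rw [← MonoidHom.comap_ker, QuotientGroup.ker_mk', radical_classMul hF hne hH hHne]

end ClassMul

/-! ### Finite nilpotent groups -/

section Nilpotent

variable {σ : Set Nat.Primes}

/-- `H` contains a Sylow subgroup for each prime, so no prime divides its index. -/
theorem eq_top_of_forall_prime_pow {G : Type*} [Group G] [Finite G] {H : Subgroup G}
    (h : ∀ (p : Nat.Primes) (x : G) (k : ℕ), x ^ ((p : ℕ) ^ k) = 1 → x ∈ H) : H = ⊤ := by
  rw [← Subgroup.index_eq_one]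
  by_contra h1
  obtain ⟨p, hp, hpd⟩ := Nat.exists_prime_and_dvd h1
  have : Fact p.Prime := ⟨hp⟩
  obtain ⟨P⟩ := (inferInstance : Nonempty (Sylow p G))
  refine P.not_dvd_index (hpd.trans (Subgroup.index_dvd_of_le fun x hx => ?_))
  obtain ⟨k, hk⟩ := P.2 ⟨x, hx⟩
  exact h ⟨p, hp⟩ x k (congrArg Subtype.val hk)

/-- A finite group is generated by its elements of prime power order. -/
theorem le_of_forall_prime_pow {G : Type*} [Group G] [Finite G] {A H : Subgroup G}
    (h : ∀ (p : Nat.Primes), ∀ x ∈ A, ∀ k : ℕ, x ^ ((p : ℕ) ^ k) = 1 → x ∈ H) : A ≤ H := by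
  rw [← Subgroup.subgroupOf_eq_top]
  exact eq_top_of_forall_prime_pow fun p x k hx =>
    h p x x.2 k (congrArg Subtype.val hx)

theorem isNilpotent_of_isPiGroup_singleton {G : Type*} [Group G] [Finite G] {p : Nat.Primes}
    (h : IsPiGroup {p} G) : Group.IsNilpotent G :=
  have : Fact (p : ℕ).Prime := ⟨p.2⟩
  (isPiGroup_singleton_iff.1 h).isNilpotent

theorem finite_of_dvd {n : ℕ} (hn : n ≠ 0) {Q : Nat.Primes → Prop}
    (h : ∀ p, Q p → (p : ℕ) ∣ n) : Finite {p // Q p} := by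
  refine Finite.of_injective
    (fun p => (⟨p.1.1, Nat.mem_divisors.2 ⟨h p.1 p.2, hn⟩⟩ : n.divisors)) fun p q hpq => ?_
  have := congrArg (fun d : n.divisors => (d : ℕ)) hpq
  exact Subtype.ext (Subtype.ext this)

theorem isNilpotent_iSup_of_commute {G : Type*} [Group G] [Finite G]
    (P : Nat.Primes → Subgroup G) (hP : ∀ p, IsPiGroup {p} (P p))
    (hcomm : Pairwise fun p q => ∀ x y : G, x ∈ P p → y ∈ P q → Commute x y) :
    Group.IsNilpotent (⨆ p, P p : Subgroup G) := by
  -- Primes not dividing the group order contribute only `⊥`; over the remaining finite index set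
  -- the join is the image of a direct product of `p`-groups.
  let ι := {p : Nat.Primes // (p : ℕ) ∣ Nat.card G}
  have hι : Finite ι := finite_of_dvd Nat.card_pos.ne' fun p hp => hp
  have := Fintype.ofFinite ι
  have hc : Pairwise fun i j : ι => ∀ x y : G, x ∈ P i → y ∈ P j → Commute x y :=
    fun i j hij => hcomm fun h => hij (Subtype.ext h)
  have hnil : ∀ i : ι, Group.IsNilpotent (P i) := fun i => isNilpotent_of_isPiGroup_singleton (hP i)
  have hr : (Subgroup.noncommPiCoprod hc).range = ⨆ p, P p := by
    rw [Subgroup.noncommPiCoprod_range]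
    refine le_antisymm (iSup_le fun i => le_iSup P i) (iSup_le fun p => ?_)
    by_cases hp : (p : ℕ) ∣ Nat.card G
    · exact le_iSup (fun i : ι => P i) ⟨p, hp⟩
    · have : P p = ⊥ := by
        refine (hP p).eq_bot_of_compl fun q hq hqp => ?_
        obtain rfl : q = p := hqp
        exact hp (hq.trans (Subgroup.card_subgroup_dvd_card _))
      rw [this]; exact bot_le
  rw [← hr]
  exact Group.nilpotent_of_surjective _ (MonoidHom.rangeRestrict_surjective _)

variable {G : Type u} [Group G] [Finite G]

/-- The largest normal `σ`-subgroup. -/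
abbrev piCore (σ : Set Nat.Primes) (G : Type u) [Group G] [Finite G] : Subgroup G :=
  radical (piGroups σ) G

theorem isPiGroup_piCore : IsPiGroup σ (piCore σ G) :=
  radical_mem (isFittingClass_piGroups σ) (nonempty_piGroups σ)

theorem le_piCore {N : Subgroup G} [hN : N.Normal] (h : IsPiGroup σ N) : N ≤ piCore σ G :=
  le_radical hN h

theorem piCore_commute {σ τ : Set Nat.Primes} (h : Disjoint σ τ) {x y : G} (hx : x ∈ piCore σ G)
    (hy : y ∈ piCore τ G) : Commute x y := by
  refine Subgroup.commute_of_normal_of_disjoint _ _ inferInstance inferInstance ?_ x y hx hy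
  rw [disjoint_iff]
  exact (isPiGroup_piCore.to_le inf_le_left).eq_bot_of_compl
    ((isPiGroup_piCore.mono h.subset_compl_left).to_le inf_le_right)

/-- Sylow subgroups of a nilpotent group are normal, so those for primes in `σ` lie in the core,
whose index is then a `σ'`-number, coprime to `n`. -/
theorem mem_piCore_of_isNilpotent [Group.IsNilpotent G] {x : G} {n : ℕ} (hn : IsPiNat σ n)
    (hx : x ^ n = 1) : x ∈ piCore σ G := by
  have hidx : IsPiNat σᶜ (piCore σ G).index := by
    refine ⟨Subgroup.index_ne_zero_of_finite, fun p hp hpσ => ?_⟩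
    have : Fact (p : ℕ).Prime := ⟨p.2⟩
    obtain ⟨P⟩ := (inferInstance : Nonempty (Sylow p G))
    refine P.not_dvd_index (hp.trans (Subgroup.index_dvd_of_le (le_piCore ?_)))
    exact (isPiGroup_singleton_iff.2 P.2).mono (Set.singleton_subset_iff.2 hpσ)
  refine mem_of_pow_mem_of_coprime (hn.coprime hidx disjoint_compl_right) ?_
    (Subgroup.pow_index_mem _ x)
  rw [hx]; exact Subgroup.one_mem _

theorem isNilpotent_le_iSup_piCore {N : Subgroup G} [N.Normal] (h : Group.IsNilpotent N) :
    N ≤ ⨆ p, piCore {p} G := by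
  refine le_of_forall_prime_pow fun p x hx k hk => ?_
  have h1 : (⟨x, hx⟩ : N) ∈ piCore {p} N :=
    mem_piCore_of_isNilpotent (.prime_pow p (Set.mem_singleton p) k) (Subtype.ext hk)
  rw [piCore, radical_normal_eq (isFittingClass_piGroups _) (nonempty_piGroups _)] at h1
  exact le_iSup (fun p => piCore {p} G) p h1

/-- Fitting's theorem: both subgroups lie in the join of the `p`-cores of `G`, which commute
elementwise and so generate a nilpotent group. -/
theorem IsNilpotent.sup {M N : Subgroup G} [M.Normal] [N.Normal] (hM : Group.IsNilpotent M)
    (hN : Group.IsNilpotent N) : Group.IsNilpotent (M ⊔ N : Subgroup G) := by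
  have h : Group.IsNilpotent (⨆ p, piCore {p} G : Subgroup G) :=
    isNilpotent_iSup_of_commute (fun p => piCore {p} G) (fun p => isPiGroup_piCore)
      fun p q hpq x y hx hy => piCore_commute (by simpa using hpq) hx hy
  have hle : M ⊔ N ≤ ⨆ p, piCore {p} G :=
    sup_le (isNilpotent_le_iSup_piCore hM) (isNilpotent_le_iSup_piCore hN)
  exact Group.nilpotent_of_mulEquiv (Subgroup.subgroupOfEquivOfLe hle)

theorem isFittingClass_nilpotentPiGroups (σ : Set Nat.Primes) :
    IsFittingClass.{u} (nilpotentPiGroups σ) where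
  iso _ _ _ _ _ _ e h :=
    ⟨have := h.1; Group.nilpotent_of_mulEquiv e, (isFittingClass_piGroups σ).iso _ _ e h.2⟩
  normal _ _ _ N _ h := ⟨have := h.1; inferInstance, h.2.to_subgroup N⟩
  sup _ _ _ _ _ _ _ h h' := ⟨IsNilpotent.sup h.1 h'.1, h.2.sup h'.2⟩

theorem nonempty_nilpotentPiGroups (σ : Set Nat.Primes) : (nilpotentPiGroups.{u} σ).Nonempty :=
  ⟨PUnit, inferInstance, inferInstance, inferInstance, IsPiGroup.of_subsingleton⟩

theorem nilpotentPiGroups_to_le {H K : Subgroup G} (h : nilpotentPiGroups σ K) (hle : H ≤ K) :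
    nilpotentPiGroups σ H :=
  ⟨have := h.1; Group.nilpotent_of_mulEquiv (Subgroup.subgroupOfEquivOfLe hle), h.2.to_le hle⟩

theorem nilpotentPiGroups_of_surjective {G' : Type u} [Group G'] [Finite G']
    (h : nilpotentPiGroups σ G) (f : G →* G') (hf : Function.Surjective f) :
    nilpotentPiGroups σ G' :=
  ⟨have := h.1; Group.nilpotent_of_surjective f hf, h.2.of_surjective f hf⟩

theorem nilpotentPiGroups_map {G' : Type u} [Group G'] [Finite G'] {H : Subgroup G}
    (h : nilpotentPiGroups σ H) (f : G →* G') : nilpotentPiGroups σ (H.map f) :=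
  nilpotentPiGroups_of_surjective h _ (f.subgroupMap_surjective H)

end Nilpotent

/-! ### The Hartley class of an invariable function -/

section Hartley

theorem piCore_mono {G : Type u} [Group G] [Finite G] {σ τ : Set Nat.Primes} (h : σ ⊆ τ) :
    piCore σ G ≤ piCore τ G :=
  le_piCore (isPiGroup_piCore.mono h)

/-- A finite group is `p`-nilpotent for all `p ∈ π` if and only if it is an extension of a
`π'`-group by a nilpotent `π`-group. -/
theorem forall_classMul_iff {π : Set Nat.Primes} {G : Type u} [Group G] [Finite G] :
    (∀ p ∈ π, classMul (piGroups {p}ᶜ) (pGroups p) G) ↔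
      classMul (piGroups πᶜ) (nilpotentPiGroups π) G := by
  simp only [pGroups_eq_piGroups]
  constructor
  · intro h
    have hx : ∀ p ∈ π, ∀ x : G, ∃ n, IsPiNat {p} n ∧ x ^ n ∈ piCore {p}ᶜ G :=
      fun p hp => isPiGroup_quotient_iff.1 (h p hp)
    have hinf : ∀ x : G, (∀ p ∈ π, x ∈ piCore {p}ᶜ G) → x ∈ piCore πᶜ G := by
      intro x hx
      let D : Subgroup G := ⨅ p ∈ π, piCore {p}ᶜ G
      have : D.Normal := Subgroup.normal_iInf_normal fun p => Subgroup.normal_iInf_normal fun _ =>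
        inferInstance
      have hD : IsPiGroup πᶜ D := fun p hp hpπ =>
        isPiGroup_piCore.to_le (iInf₂_le p hpπ : D ≤ piCore {p}ᶜ G) p hp rfl
      exact le_piCore hD (by simpa [D, Subgroup.mem_iInf] using hx)
    have hpi : IsPiGroup π (G ⧸ piCore πᶜ G) := by
      refine isPiGroup_quotient_iff.2 fun x => ?_
      -- The `π`-part `a` of the order works for every `x` and all `p ∈ π` at once: `x ^ a` has a
      -- `p`-power in the `p'`-core, and its `b`-th power is trivial with `b` prime to `p`.
      obtain ⟨a, b, ha, hb, hab⟩ := IsPiNat.exists_mul π (Nat.card_pos (α := G)).ne'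
      refine ⟨a, ha, hinf _ fun p hp => ?_⟩
      obtain ⟨n, hn, hxn⟩ := hx p hp x
      refine mem_of_pow_mem_of_coprime (hn.coprime hb ?_) (m := n) (n := b) ?_ ?_
      · simpa using hp
      · rw [← pow_mul, mul_comm, pow_mul]; exact Subgroup.pow_mem _ hxn _
      · rw [← pow_mul, ← hab, pow_card_eq_one']; exact Subgroup.one_mem _
    refine ⟨?_, hpi⟩
    let ι := {p : Nat.Primes // p ∈ π ∧ (p : ℕ) ∣ Nat.card G}
    have hι : Finite ι := finite_of_dvd (Nat.card_pos (α := G)).ne' fun p hp => hp.2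
    -- The kernel is the `π'`-core, so the quotient by it embeds into a finite product of groups of
    -- prime power order and is nilpotent.
    let f : G →* (∀ i : ι, G ⧸ piCore {i.1}ᶜ G) :=
      MonoidHom.pi fun i => QuotientGroup.mk' (piCore {i.1}ᶜ G)
    have hker : f.ker = piCore πᶜ G := by
      ext x
      have : x ∈ f.ker ↔ ∀ i : ι, x ∈ piCore {i.1}ᶜ G := by
        rw [MonoidHom.mem_ker, funext_iff]
        exact forall_congr' fun i => QuotientGroup.eq_one_iff x
      rw [this]
      constructor
      · intro hxi
        refine hinf x fun p hp => ?_
        by_cases hpd : (p : ℕ) ∣ Nat.card G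
        · exact hxi ⟨p, hp, hpd⟩
        · have htop : IsPiGroup {p}ᶜ (⊤ : Subgroup G) := by
            rintro q hq rfl
            exact hpd (hq.trans (Subgroup.card_subgroup_dvd_card _))
          exact le_piCore htop (Subgroup.mem_top x)
      · intro hxπ i
        exact piCore_mono (Set.compl_subset_compl.2 (Set.singleton_subset_iff.2 i.2.1)) hxπ
    have hnil : ∀ i : ι, Group.IsNilpotent (G ⧸ piCore {i.1}ᶜ G) := fun i =>
      isNilpotent_of_isPiGroup_singleton (h i.1 i.2.1)
    exact Group.nilpotent_of_mulEquiv (quotientEquivRange f _ hker).symm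
  · intro h p hp
    have hnil : Group.IsNilpotent (G ⧸ piCore πᶜ G) := h.1
    refine isPiGroup_quotient_iff.2 fun x => ?_
    obtain ⟨a, b, ha, hb, hab⟩ := IsPiNat.exists_mul {p} (Nat.card_pos (α := G)).ne'
    refine ⟨a, ha, ?_⟩
    -- The preimage is an extension of a `π'`-group by a `p'`-group, and `p ∈ π`; it therefore lies
    -- in the `p'`-core of `G`.
    have hN : IsPiGroup {p}ᶜ ((piCore {p}ᶜ (G ⧸ piCore πᶜ G)).comap
        (QuotientGroup.mk' (piCore πᶜ G))) := by
      refine isPiGroup_subgroup_iff.2 fun y hy => ?_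
      obtain ⟨m, hm, hym⟩ := isPiGroup_subgroup_iff.1 isPiGroup_piCore _ hy
      have hy' : y ^ m ∈ piCore πᶜ G := (QuotientGroup.eq_one_iff _).1 hym
      obtain ⟨n, hn, hyn⟩ := isPiGroup_subgroup_iff.1 isPiGroup_piCore _ hy'
      exact ⟨m * n, hm.mul (hn.mono (Set.compl_subset_compl.2 (Set.singleton_subset_iff.2 hp))),
        by rw [pow_mul, hyn]⟩
    refine le_piCore hN ?_
    refine mem_piCore_of_isNilpotent hb ?_
    rw [← map_pow, ← pow_mul, ← hab, pow_card_eq_one', map_one]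

/-- Associativity brings `X` to the front on both sides; the comparison then takes place in the
quotient by the `X`-radical, where it is `forall_classMul_iff`. -/
theorem hartleyClass_eq (h : HFunction.{u}) {X : GroupClass.{u}} (hX : IsFittingClass X)
    (hXne : X.Nonempty) (hinv : ∀ p ∈ h.supp, h.toFun p = X) :
    hartleyClass h = classMul (classMul X (piGroups h.suppᶜ)) (nilpotentPiGroups h.supp) := by
  rw [classMul_assoc hX hXne (isFittingClass_piGroups _) (nonempty_piGroups _)
    (isFittingClass_nilpotentPiGroups _)]
  funext G _ _
  refine propext (Iff.trans ?_ forall_classMul_iff)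
  refine forall₂_congr fun p hp => ?_
  rw [hinv p hp, classMul_assoc hX hXne (isFittingClass_piGroups _) (nonempty_piGroups _)
    (by rw [pGroups_eq_piGroups]; exact isFittingClass_piGroups _)]
  rfl

end Hartley

/-! ### Sylow subgroups of subgroups -/

section SylowIn

variable {G : Type*} [Group G] [Finite G] {p : Nat.Primes} {C P Q : Subgroup G}

/-- The index of `B ⊓ M` is computed once through `B` and once through `M`, and the common factor is
cancelled. -/
theorem relIndex_dvd_index_of_normal_right (B M : Subgroup G) [M.Normal] :
    B.relIndex M ∣ B.index := by
  obtain ⟨t, ht⟩ := Subgroup.relIndex_dvd_index_of_normal M B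
  have h1 := Subgroup.relIndex_mul_index (inf_le_left : B ⊓ M ≤ B)
  rw [← Subgroup.relIndex_mul_index (inf_le_right : B ⊓ M ≤ M), Subgroup.inf_relIndex_right,
    Subgroup.inf_relIndex_left, ht, mul_left_comm] at h1
  exact ⟨t, Nat.eq_of_mul_eq_mul_left
    (Nat.pos_of_ne_zero Subgroup.index_ne_zero_of_finite) h1⟩

/-- `P` is a Sylow `p`-subgroup of the subgroup `C`. -/
structure IsSylowIn (p : Nat.Primes) (C P : Subgroup G) : Prop where
  le : P ≤ C
  isPiGroup : IsPiGroup {p} P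
  not_dvd : ¬ (p : ℕ) ∣ P.relIndex C

theorem IsSylowIn.exists_sylow (h : IsSylowIn p C P) :
    ∃ S : Sylow p C, (S : Subgroup C).map C.subtype = P := by
  have : Fact (p : ℕ).Prime := ⟨p.2⟩
  have hP : IsPGroup p (P.subgroupOf C) :=
    (isPiGroup_singleton_iff.1 h.isPiGroup).of_equiv (Subgroup.subgroupOfEquivOfLe h.le).symm
  refine ⟨hP.toSylow h.not_dvd, ?_⟩
  exact Subgroup.map_subgroupOf_eq_of_le h.le

theorem isSylowIn_map (S : Sylow p C) : IsSylowIn p C ((S : Subgroup C).map C.subtype) := by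
  have : Fact (p : ℕ).Prime := ⟨p.2⟩
  refine ⟨Subgroup.map_subtype_le _, isPiGroup_singleton_iff.2 (S.2.map _), ?_⟩
  rw [Subgroup.relIndex, Subgroup.subgroupOf,
    Subgroup.comap_map_eq_self_of_injective C.subtype_injective]
  exact S.not_dvd_index

theorem exists_isSylowIn_ge (hQ : Q ≤ C) (h : IsPiGroup {p} Q) : ∃ P, IsSylowIn p C P ∧ Q ≤ P := by
  have hQ' : IsPGroup p (Q.subgroupOf C) :=
    (isPiGroup_singleton_iff.1 h).of_equiv (Subgroup.subgroupOfEquivOfLe hQ).symm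
  obtain ⟨S, hS⟩ := hQ'.exists_le_sylow
  refine ⟨_, isSylowIn_map S, ?_⟩
  rw [← Subgroup.map_subgroupOf_eq_of_le hQ]
  exact Subgroup.map_mono hS

theorem exists_isSylowIn (p : Nat.Primes) (C : Subgroup G) : ∃ P, IsSylowIn p C P :=
  (exists_isSylowIn_ge bot_le IsPiGroup.of_subsingleton).imp fun _ h => h.1

theorem IsSylowIn.eq_of_le (h : IsSylowIn p C P) (hQ : IsPiGroup {p} Q) (hQC : Q ≤ C)
    (hle : P ≤ Q) : Q = P := by
  refine le_antisymm ?_ hle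
  rw [← Subgroup.relIndex_eq_one]
  obtain ⟨k, hk⟩ : ∃ k, P.relIndex Q = (p : ℕ) ^ k :=
    ((isPiGroup_iff_card.1 hQ).of_dvd (Subgroup.relIndex_dvd_card P Q)).eq_prime_pow
  have hd : P.relIndex Q ∣ P.relIndex C :=
    ⟨Q.relIndex C, (Subgroup.relIndex_mul_relIndex P Q C hle hQC).symm⟩
  rcases k with _ | k
  · simpa using hk
  · exact absurd ((hk ▸ dvd_pow_self _ k.succ_ne_zero).trans hd) h.not_dvd

theorem IsSylowIn.exists_conj (hP : IsSylowIn p C P) (hQ : IsSylowIn p C Q) :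
    ∃ c ∈ C, P.map (MulAut.conj c).toMonoidHom = Q := by
  have : Fact (p : ℕ).Prime := ⟨p.2⟩
  obtain ⟨S, rfl⟩ := hP.exists_sylow
  obtain ⟨T, rfl⟩ := hQ.exists_sylow
  obtain ⟨c, rfl⟩ := MulAction.exists_smul_eq C S T
  refine ⟨c, c.2, ?_⟩
  refine (Subgroup.map_map (S : Subgroup C) _ _).trans ?_
  exact (Subgroup.map_map (S : Subgroup C) C.subtype (MulAut.conj c).toMonoidHom).symm

theorem IsSylowIn.normal_le (hP : IsSylowIn p C P) {R : Subgroup G} [R.Normal]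
    (hR : IsPiGroup {p} R) (hRC : R ≤ C) : R ≤ P := by
  have h : P ⊔ R = P := hP.eq_of_le (hP.isPiGroup.sup hR) (sup_le hP.le hRC) le_sup_left
  exact h ▸ le_sup_right

/-- At each normal step of the chain, the new relative index divides the previous one, so it stays
prime to `p`. -/
theorem IsSylowIn.inf_subnormal (hP : IsSylowIn p C P) {N : Subgroup G} (hN : N.IsSubnormal) :
    IsSylowIn p (C ⊓ N) (P ⊓ N) := by
  induction hN with
  | top => simpa using hP
  | step H K hle _ hn ih =>
    refine ⟨inf_le_inf_right H hP.le, hP.isPiGroup.to_le inf_le_left, fun hd => ih.not_dvd ?_⟩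
    refine hd.trans ?_
    have hCn : ((C ⊓ H).subgroupOf (C ⊓ K)).Normal := by
      rw [Subgroup.normal_subgroupOf_iff_le_normalizer hle] at hn
      rw [Subgroup.normal_subgroupOf_iff_le_normalizer (inf_le_inf_left C hle)]
      exact (inf_le_inf Subgroup.le_normalizer hn).trans Subgroup.inf_normalizer_le_normalizer_inf
    have h1 : (P ⊓ H) = (P ⊓ K) ⊓ (C ⊓ H) := by
      apply le_antisymm
      · exact le_inf (inf_le_inf_left P hle) (inf_le_inf_right H hP.le)
      · exact le_inf (inf_le_left.trans inf_le_left) (inf_le_right.trans inf_le_right)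
    rw [h1, Subgroup.inf_relIndex_right]
    rw [← Subgroup.relIndex_subgroupOf (inf_le_inf_left C hle)]
    exact relIndex_dvd_index_of_normal_right _ _

end SylowIn

/-! ### Decomposition of elements and coprime action -/

theorem eq_one_of_coprime_pow {G : Type*} [Group G] {σ : Set Nat.Primes} {z : G} {m n : ℕ}
    (hm : IsPiNat σ m) (hn : IsPiNat σᶜ n) (hzm : z ^ m = 1) (hzn : z ^ n = 1) : z = 1 :=
  mem_of_pow_mem_of_coprime (H := ⊥) (hm.coprime hn disjoint_compl_right) hzm hzn

section Elements

variable {G : Type*} [Group G] [Finite G] {σ : Set Nat.Primes}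

theorem exists_mul_eq_of_isPiNat (σ : Set Nat.Primes) (z : G) :
    ∃ z₁ ∈ Subgroup.zpowers z, ∃ z₂ ∈ Subgroup.zpowers z, z = z₂ * z₁ ∧
      (∃ a, IsPiNat σ a ∧ z₁ ^ a = 1) ∧ ∃ b, IsPiNat σᶜ b ∧ z₂ ^ b = 1 := by
  obtain ⟨a, b, ha, hb, hab⟩ := IsPiNat.exists_mul σ (orderOf_pos z).ne'
  have hz : z ^ (a * b) = 1 := hab ▸ pow_orderOf_eq_one z
  have := Nat.gcd_eq_gcd_ab a b
  rw [ha.coprime hb disjoint_compl_right] at this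
  refine ⟨(z ^ b) ^ (a.gcdB b), zpow_mem (pow_mem (Subgroup.mem_zpowers z) _) _,
    (z ^ a) ^ (a.gcdA b), zpow_mem (pow_mem (Subgroup.mem_zpowers z) _) _, ?_,
    ⟨a, ha, ?_⟩, ⟨b, hb, ?_⟩⟩
  · rw [← zpow_natCast z a, ← zpow_natCast z b, ← zpow_mul, ← zpow_mul, ← zpow_add, ← this]
    simp
  · rw [← zpow_natCast, zpow_comm, zpow_natCast, ← pow_mul, mul_comm, hz, one_zpow]
  · rw [← zpow_natCast, zpow_comm, zpow_natCast, ← pow_mul, hz, one_zpow]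

/-- A `σ`-element of a subnormal subgroup `N` centralizing `A ⊓ N`, where `A` is a normal
`σ'`-subgroup, centralizes `A`. -/
theorem commute_of_commute_inf_subnormal {A N : Subgroup G} [hA : A.Normal]
    (hAσ : IsPiGroup σᶜ A) (hN : N.IsSubnormal) {x : G} (hx : x ∈ N) {m : ℕ} (hm : IsPiNat σ m)
    (hxm : x ^ m = 1) (h : ∀ y ∈ A ⊓ N, Commute x y) : ∀ y ∈ A, Commute x y := by
  induction hN with
  | top => simpa using h
  | step H K hle _ hn ih =>
    refine ih (hle hx) fun y hy => ?_
    rw [Subgroup.normal_subgroupOf_iff hle] at hn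
    have hzA : y⁻¹ * (x * y * x⁻¹) ∈ A := A.mul_mem (A.inv_mem hy.1) (hA.conj_mem y hy.1 x)
    have hzH : y⁻¹ * (x * y * x⁻¹) ∈ H := by
      have := H.mul_mem (hn x y⁻¹ hx (K.inv_mem hy.2)) (H.inv_mem hx)
      simpa [mul_assoc] using this
    obtain ⟨z, hz⟩ : ∃ z, z = y⁻¹ * (x * y * x⁻¹) := ⟨_, rfl⟩
    rw [← hz] at hzA hzH
    have hc : Commute x z := h z ⟨hzA, hzH⟩
    have hxy : x * y * x⁻¹ = y * z := by rw [hz]; group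
    -- The commutator `z` lies in `A ⊓ H`, hence commutes with `x`, and conjugating by powers of `x`
    -- accumulates powers of `z`. Taking `n = m` gives `z ^ m = 1`, while `z` is a `σ'`-element.
    have hpow : ∀ n : ℕ, x ^ n * y * (x ^ n)⁻¹ = y * z ^ n := by
      intro n
      induction n with
      | zero => simp
      | succ n ihn =>
        calc x ^ (n + 1) * y * (x ^ (n + 1))⁻¹ = x * (x ^ n * y * (x ^ n)⁻¹) * x⁻¹ := by
              rw [pow_succ']; group
          _ = (x * y * x⁻¹) * (x * z ^ n * x⁻¹) := by rw [ihn]; group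
          _ = y * z ^ (n + 1) := by
              rw [hxy, (hc.pow_right n).eq, mul_inv_cancel_right, mul_assoc, ← pow_succ']
    have hzm : z ^ m = 1 := by
      have := hpow m
      rw [hxm] at this
      simpa using this
    obtain ⟨n, hn', hzn⟩ := isPiGroup_subgroup_iff.1 hAσ z hzA
    rw [eq_one_of_coprime_pow hm hn' hzm hzn, mul_one, mul_inv_eq_iff_eq_mul] at hxy
    exact hxy

end Elements

/-! ### Maximal nilpotent `π`-subgroups containing a self-centralizing normal subgroup -/

section Core

variable {G : Type u} [Group G] [Finite G] {π σ τ : Set Nat.Primes} {p q : Nat.Primes}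

/-- The largest normal `σ`-subgroup of a subgroup. -/
abbrev relCore (σ : Set Nat.Primes) (W : Subgroup G) : Subgroup G :=
  relRadical (piGroups σ) W

theorem isPiGroup_relCore {W : Subgroup G} : IsPiGroup σ (relCore σ W) :=
  relRadical_mem (isFittingClass_piGroups σ) (nonempty_piGroups σ) W

theorem relCore_normal {W : Subgroup G} [W.Normal] : (relCore σ W).Normal :=
  radical_map_subtype_normal (isFittingClass_piGroups σ) W

theorem mem_relCore {W : Subgroup G} (hW : Group.IsNilpotent W) {x : G} (hx : x ∈ W) {n : ℕ}
    (hn : IsPiNat σ n) (hxn : x ^ n = 1) : x ∈ relCore σ W :=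
  ⟨⟨x, hx⟩, mem_piCore_of_isNilpotent hn (Subtype.ext hxn), rfl⟩

theorem le_relCore {P W : Subgroup G} (hW : Group.IsNilpotent W) (h : P ≤ W)
    (hP : IsPiGroup σ P) : P ≤ relCore σ W := fun x hx =>
  have ⟨_, hn, hxn⟩ := isPiGroup_subgroup_iff.1 hP x hx
  mem_relCore hW (h hx) hn hxn

theorem relCore_commute {W : Subgroup G} (h : Disjoint σ τ) {x y : G} (hx : x ∈ relCore σ W)
    (hy : y ∈ relCore τ W) : Commute x y := by
  obtain ⟨x, hx, rfl⟩ := hx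
  obtain ⟨y, hy, rfl⟩ := hy
  exact (piCore_commute h hx hy).map W.subtype

theorem IsPiGroup.eq_one_of_pow {W : Subgroup G} (hW : IsPiGroup π W) (hp : p ∉ π) {x : G}
    (hx : x ∈ W) {k : ℕ} (hxk : x ^ ((p : ℕ) ^ k) = 1) : x = 1 := by
  obtain ⟨n, hn, hxn⟩ := isPiGroup_subgroup_iff.1 hW x hx
  exact eq_one_of_coprime_pow hn (.prime_pow p hp k) hxn hxk

/-- The centralizer of the `p'`-part of a subgroup. -/
def pCent (F : Subgroup G) (p : Nat.Primes) : Subgroup G :=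
  Subgroup.centralizer (relCore {p}ᶜ F : Set G)

theorem mem_pCent {F : Subgroup G} {x : G} :
    x ∈ pCent F p ↔ ∀ y ∈ relCore {p}ᶜ F, Commute x y := by
  rw [pCent, Subgroup.mem_centralizer_iff]
  exact forall₂_congr fun y _ => eq_comm

theorem pCent_normal {F : Subgroup G} [F.Normal] : (pCent F p).Normal :=
  have := relCore_normal (σ := {p}ᶜ) (W := F)
  inferInstanceAs (Subgroup.centralizer _).Normal

theorem relCore_le_pCent {F : Subgroup G} : relCore {p} F ≤ pCent F p := fun _ hx =>
  mem_pCent.2 fun _ hy => relCore_commute disjoint_compl_right hx hy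

theorem relCore_le_pCent_of_le {F W : Subgroup G} (hW : Group.IsNilpotent W) (h : F ≤ W) :
    relCore {p} W ≤ pCent F p := fun _ hx =>
  mem_pCent.2 fun _ hy => relCore_commute disjoint_compl_right hx
    (le_relCore hW ((relRadical_le F).trans h) isPiGroup_relCore hy)

/-- An element of `F` of `r`-power order lies in the `p'`-part of `F` if `r ≠ p`, and in the
`q'`-part if `r = p`. -/
theorem pCent_inf_le {F : Subgroup G} (hF : Group.IsNilpotent F) (hpq : p ≠ q) :
    pCent F p ⊓ pCent F q ≤ Subgroup.centralizer (F : Set G) := by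
  intro x hx
  have : F ≤ Subgroup.centralizer {x} := by
    refine le_of_forall_prime_pow fun r y hy k hyk => ?_
    rw [Subgroup.mem_centralizer_singleton_iff]
    by_cases hr : r = p
    · exact ((mem_pCent.1 hx.2) y (mem_relCore hF hy (.prime_pow r (by simpa [hr]) k) hyk)).eq.symm
    · exact ((mem_pCent.1 hx.1) y (mem_relCore hF hy (.prime_pow r (by simpa) k) hyk)).eq.symm
  rw [Subgroup.mem_centralizer_iff]
  exact fun y hy => Subgroup.mem_centralizer_singleton_iff.1 (this hy)

/-- `pCent F p` normalizes the Sylow `q`-subgroups of `pCent F q`, for `p ≠ q`. -/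
theorem conj_mem_of_mem_pCent {F : Subgroup G} [F.Normal] (hF : Group.IsNilpotent F)
    (hcent : Subgroup.centralizer (F : Set G) ≤ F) (hpq : p ≠ q) {c : G} (hc : c ∈ pCent F p)
    {Q : Subgroup G} (hQ : IsSylowIn q (pCent F q) Q) {y : G} (hy : y ∈ Q) : c * y * c⁻¹ ∈ Q := by
  have hpn := pCent_normal (F := F) (p := p)
  have hqn := pCent_normal (F := F) (p := q)
  have hyC := hQ.le hy
  -- Both centralizers are normal, so the commutator lies in their intersection, which centralizes
  -- `F`.
  have hz : c * y * c⁻¹ * y⁻¹ ∈ F := by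
    refine hcent (pCent_inf_le hF hpq ⟨?_, ?_⟩)
    · have := (pCent F p).mul_mem hc (hpn.conj_mem _ ((pCent F p).inv_mem hc) y)
      simpa [mul_assoc] using this
    · exact (pCent F q).mul_mem (hqn.conj_mem _ hyC c) ((pCent F q).inv_mem hyC)
  obtain ⟨z₁, hz₁, z₂, hz₂, hzz, ⟨a, ha, hza⟩, b, hb, hzb⟩ :=
    exists_mul_eq_of_isPiNat {q} (c * y * c⁻¹ * y⁻¹)
  have hle : Subgroup.zpowers (c * y * c⁻¹ * y⁻¹) ≤ F := (Subgroup.zpowers_le).2 hz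
  have hz₁' : z₁ ∈ relCore {q} F := mem_relCore hF (hle hz₁) ha hza
  have hz₂' : z₂ ∈ relCore {q}ᶜ F := mem_relCore hF (hle hz₂) hb hzb
  have hz₁Q : z₁ ∈ Q :=
    have := relCore_normal (σ := {q}) (W := F)
    hQ.normal_le isPiGroup_relCore relCore_le_pCent hz₁'
  have hw : z₁ * y ∈ Q := mul_mem hz₁Q hy
  have hcomm : Commute (z₁ * y) z₂ := mem_pCent.1 (hQ.le hw) z₂ hz₂'
  have heq : c * y * c⁻¹ = z₂ * (z₁ * y) := by
    rw [← mul_assoc, ← hzz]; group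
  have hn := isPiGroup_iff_card.1 hQ.isPiGroup
  have hpow : ∀ w ∈ Q, w ^ Nat.card Q = 1 := fun w hw =>
    congrArg Subtype.val (pow_card_eq_one' (x := (⟨w, hw⟩ : Q)))
  -- The `q'`-part `z₂` of the commutator commutes with `z₁ * y ∈ Q`, and the product of the two is
  -- a conjugate of a `q`-element. So `z₂` is also a `q`-element, hence trivial.
  have h1 : (c * y * c⁻¹) ^ Nat.card Q = 1 := by rw [conj_pow, hpow y hy]; simp
  rw [heq, hcomm.symm.mul_pow, hpow _ hw, mul_one] at h1
  rw [heq, eq_one_of_coprime_pow hn hb h1 hzb, one_mul]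
  exact hw

end Core

/-! ### Maximal nilpotent `π`-subgroups as products of Sylow subgroups of the `pCent F p`. -/

section Core

variable {G : Type u} [Group G] [Finite G] {π : Set Nat.Primes} {p : Nat.Primes}

/-- A normal nilpotent `π`-subgroup containing its centralizer. -/
structure IsSelfCentralizing (π : Set Nat.Primes) (F : Subgroup G) : Prop where
  normal : F.Normal
  mem : nilpotentPiGroups π F
  centralizer_le : Subgroup.centralizer (F : Set G) ≤ F

variable {F : Subgroup G}

namespace IsSelfCentralizing

/-- Sylow subgroups of the groups `pCent F p`, for `p ∈ π`, generate a nilpotent `π`-subgroup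
containing `F`. -/
theorem iSup_mem (hF : IsSelfCentralizing π F) {P : Nat.Primes → Subgroup G}
    (hP : ∀ p ∈ π, IsSylowIn p (pCent F p) (P p)) (hP' : ∀ p ∉ π, P p = ⊥) :
    nilpotentPiGroups π (⨆ p, P p : Subgroup G) ∧ F ≤ ⨆ p, P p := by
  have := hF.normal
  have hpi : ∀ p, IsPiGroup {p} (P p) := by
    intro p
    by_cases hp : p ∈ π
    · exact (hP p hp).isPiGroup
    · rw [hP' p hp]; exact IsPiGroup.of_subsingleton
  have hcomm : Pairwise fun p q => ∀ x y : G, x ∈ P p → y ∈ P q → Commute x y := by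
    intro p q hpq x y hx hy
    by_cases hp : p ∈ π; swap
    · rw [hP' p hp, Subgroup.mem_bot] at hx
      rw [hx]; exact Commute.one_left y
    by_cases hq : q ∈ π; swap
    · rw [hP' q hq, Subgroup.mem_bot] at hy
      rw [hy]; exact Commute.one_right x
    -- Each Sylow subgroup normalizes the other, so the commutator lies in the intersection of a
    -- `p`-group and a `q`-group.
    have h1 : x * y * x⁻¹ * y⁻¹ ∈ P q := (P q).mul_mem
      (conj_mem_of_mem_pCent hF.mem.1 hF.centralizer_le hpq ((hP p hp).le hx) (hP q hq) hy)
      ((P q).inv_mem hy)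
    have h2 : x * y * x⁻¹ * y⁻¹ ∈ P p := by
      have := (P p).mul_mem hx (conj_mem_of_mem_pCent hF.mem.1 hF.centralizer_le hpq.symm
        ((hP q hq).le hy) (hP p hp) ((P p).inv_mem hx))
      simpa [mul_assoc] using this
    have h3 : P p ⊓ P q = ⊥ :=
      ((hpi p).to_le inf_le_left).eq_bot_of_compl
        (((hpi q).mono (by simpa [eq_comm] using hpq.symm)).to_le inf_le_right)
    have h4 : x * y * x⁻¹ * y⁻¹ = 1 := (Subgroup.mem_bot).1 (h3 ▸ ⟨h2, h1⟩)
    exact mul_inv_eq_iff_eq_mul.1 (mul_inv_eq_one.1 h4)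
  have hnil := isNilpotent_iSup_of_commute P hpi hcomm
  refine ⟨⟨hnil, ?_⟩, ?_⟩
  · refine isPiGroup_relCore.to_le (K := relCore π (⨆ p, P p)) (iSup_le fun p => ?_)
    by_cases hp : p ∈ π
    · exact le_relCore hnil (le_iSup P p) ((hpi p).mono (Set.singleton_subset_iff.2 hp))
    · rw [hP' p hp]; exact bot_le
  · refine le_of_forall_prime_pow fun p x hx k hxk => ?_
    by_cases hp : p ∈ π
    · have := relCore_normal (σ := {p}) (W := F)
      exact le_iSup P p ((hP p hp).normal_le isPiGroup_relCore relCore_le_pCent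
        (mem_relCore hF.mem.1 hx (.prime_pow p (Set.mem_singleton p) k) hxk))
    · rw [hF.mem.2.eq_one_of_pow hp hx hxk]; exact Subgroup.one_mem _

variable {V W : Subgroup G}

/-- For nilpotent `U` above `V`, the `p`-part of `U` centralizes the `p'`-part of `F`; it is thus a
`p`-subgroup of `pCent F p` containing a Sylow subgroup that already lies in `V`. -/
theorem isMaximalIn_of_isSylowIn (hV : nilpotentPiGroups π V) (hFV : F ≤ V)
    (h : ∀ p ∈ π, ∃ P ≤ V, IsSylowIn p (pCent F p) P) : IsMaximalIn (nilpotentPiGroups π) V := by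
  refine ⟨hV, fun U hVU hU => le_antisymm (le_of_forall_prime_pow fun p x hx k hxk => ?_) hVU⟩
  by_cases hp : p ∈ π
  · obtain ⟨P, hPV, hP⟩ := h p hp
    refine hPV ?_
    rw [← hP.eq_of_le isPiGroup_relCore (relCore_le_pCent_of_le hU.1 (hFV.trans hVU))
      (le_relCore hU.1 (hPV.trans hVU) hP.isPiGroup)]
    exact mem_relCore hU.1 hx (.prime_pow p (Set.mem_singleton p) k) hxk
  · rw [hU.2.eq_one_of_pow hp hx hxk]; exact Subgroup.one_mem _

theorem isMaximalIn_iSup (hF : IsSelfCentralizing π F) (P : Nat.Primes → Subgroup G)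
    (hP : ∀ p ∈ π, IsSylowIn p (pCent F p) (P p)) (hP' : ∀ p ∉ π, P p = ⊥) :
    IsMaximalIn (nilpotentPiGroups π) (⨆ p, P p : Subgroup G) :=
  isMaximalIn_of_isSylowIn (hF.iSup_mem hP hP').1 (hF.iSup_mem hP hP').2
    fun p hp => ⟨P p, le_iSup P p, hP p hp⟩

/-- Enlarge the `p`-part of `V` to a Sylow subgroup of `pCent F p` for all `p ∈ π` simultaneously.
These generate a nilpotent `π`-group above `V`, which is `V` by maximality. -/
theorem isSylowIn_relCore (hF : IsSelfCentralizing π F) (hFV : F ≤ V)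
    (hV : IsMaximalIn (nilpotentPiGroups π) V) (hp : p ∈ π) :
    IsSylowIn p (pCent F p) (relCore {p} V) := by
  classical
  choose Q hQ hVQ using fun p : Nat.Primes =>
    exists_isSylowIn_ge (relCore_le_pCent_of_le (p := p) hV.1.1 hFV) isPiGroup_relCore
  have hP : ∀ p ∈ π, IsSylowIn p (pCent F p) (if p ∈ π then Q p else ⊥) := fun p hp => by
    rw [if_pos hp]; exact hQ p
  have hP' : ∀ p ∉ π, (if p ∈ π then Q p else ⊥) = ⊥ := fun p hp => if_neg hp
  have hle : V ≤ ⨆ p, (if p ∈ π then Q p else ⊥) := by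
    refine le_of_forall_prime_pow fun p x hx k hxk => ?_
    by_cases hp : p ∈ π
    · refine le_iSup (fun p => if p ∈ π then Q p else ⊥) p ?_
      rw [if_pos hp]
      exact hVQ p (mem_relCore hV.1.1 hx (.prime_pow p (Set.mem_singleton p) k) hxk)
    · rw [hV.1.2.eq_one_of_pow hp hx hxk]; exact Subgroup.one_mem _
  have heq := hV.2 _ hle (hF.iSup_mem hP hP').1
  have hQV : Q p ≤ V := by
    have h := le_iSup (fun p => if p ∈ π then Q p else ⊥) p
    rw [heq] at h
    simpa [hp] using h
  rw [le_antisymm (hVQ p) (le_relCore hV.1.1 hQV (hQ p).isPiGroup)]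
  exact hQ p

theorem exists_conj (hF : IsSelfCentralizing π F) (hFV : F ≤ V) (hFW : F ≤ W)
    (hV : IsMaximalIn (nilpotentPiGroups π) V) (hW : IsMaximalIn (nilpotentPiGroups π) W) :
    ∃ g : G, V.map (MulAut.conj g).toMonoidHom = W := by
  classical
  have := hF.normal
  have key : ∀ s : Finset Nat.Primes, (∀ p ∈ s, p ∈ π) → ∃ g : G, ∀ p ∈ s, ∀ x ∈ relCore {p} V,
      g * x * g⁻¹ ∈ relCore {p} W := by
    intro s
    induction s using Finset.induction_on with
    | empty => exact fun _ => ⟨1, by simp⟩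
    | insert p s hps ih =>
      intro hs
      obtain ⟨g, hg⟩ := ih fun q hq => hs q (Finset.mem_insert_of_mem hq)
      have hp : p ∈ π := hs p (Finset.mem_insert_self p s)
      have hpn := pCent_normal (F := F) (p := p)
      have hVp := hF.isSylowIn_relCore hFV hV hp
      have hWp := hF.isSylowIn_relCore hFW hW hp
      obtain ⟨Q, hQ, hgQ⟩ := exists_isSylowIn_ge (p := p) (C := pCent F p)
        (Q := (relCore {p} V).map (MulAut.conj g).toMonoidHom)
        (by
          rintro _ ⟨x, hx, rfl⟩
          exact hpn.conj_mem x (hVp.le hx) g)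
        (hVp.isPiGroup.map _)
      obtain ⟨c, hc, hcQ⟩ := hQ.exists_conj hWp
      refine ⟨c * g, fun q hq x hx => ?_⟩
      have hcg : c * g * x * (c * g)⁻¹ = c * (g * x * g⁻¹) * c⁻¹ := by group
      rw [hcg]
      rcases Finset.mem_insert.1 hq with rfl | hqs
      · rw [← hcQ]
        exact ⟨_, hgQ ⟨x, hx, rfl⟩, rfl⟩
      -- The correction `c` at `p` was taken in `pCent F p`, so it does not disturb the primes
      -- already treated.
      · exact conj_mem_of_mem_pCent hF.mem.1 hF.centralizer_le (fun h : p = q => hps (by rwa [h])) hc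
          (hF.isSylowIn_relCore hFW hW (hs q hq)) (hg q hqs x hx)
  have hfin : {p : Nat.Primes | p ∈ π ∧ (p : ℕ) ∣ Nat.card G}.Finite :=
    
    Set.finite_coe_iff.1 (finite_of_dvd Nat.card_pos.ne' fun p hp => hp.2)
  obtain ⟨g, hg⟩ := key hfin.toFinset fun p hp => (hfin.mem_toFinset.1 hp).1
  refine ⟨g, ?_⟩
  have hle : V ≤ W.comap (MulAut.conj g).toMonoidHom := by
    refine le_of_forall_prime_pow fun p x hx k hxk => ?_
    by_cases hp : p ∈ π ∧ (p : ℕ) ∣ Nat.card G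
    · exact relRadical_le W (hg p (hfin.mem_toFinset.2 hp) x
        (mem_relCore hV.1.1 hx (.prime_pow p (Set.mem_singleton p) k) hxk))
    · have hx1 : x = 1 := by
        by_cases hpπ : p ∈ π
        · refine orderOf_eq_one_iff.1 ?_
          obtain ⟨j, -, hj⟩ := (Nat.dvd_prime_pow p.2).1 (orderOf_dvd_of_pow_eq_one hxk)
          rcases j with _ | j
          · simpa using hj
          · exact absurd ⟨hpπ, ((hj ▸ dvd_pow_self _ j.succ_ne_zero).trans
              (orderOf_dvd_natCard x))⟩ hp
        · exact hV.1.2.eq_one_of_pow hpπ hx hxk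
      rw [hx1]; exact Subgroup.one_mem _
  have hcomap : W.comap (MulAut.conj g).toMonoidHom = W.map (MulAut.conj g).symm.toMonoidHom :=
    Subgroup.comap_equiv_eq_map_symm' (MulAut.conj g) W
  -- Maximality of `V` turns the inclusion into the conjugate of `W` into an equality.
  have := hV.2 _ hle (hcomap ▸ nilpotentPiGroups_map hW.1 _)
  rw [← this, Subgroup.map_comap_eq_self_of_surjective (MulAut.conj g).surjective]

theorem normal_le (hF : IsSelfCentralizing π F) (hFV : F ≤ V)
    (hV : IsMaximalIn (nilpotentPiGroups π) V) {R : Subgroup G} [R.Normal]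
    (hR : nilpotentPiGroups π R) (hFR : F ≤ R) : R ≤ V := by
  refine le_of_forall_prime_pow fun p x hx k hxk => ?_
  by_cases hp : p ∈ π
  · have := relCore_normal (σ := {p}) (W := R)
    exact relRadical_le V ((hF.isSylowIn_relCore hFV hV hp).normal_le isPiGroup_relCore
      (relCore_le_pCent_of_le hR.1 hFR)
      (mem_relCore hR.1 hx (.prime_pow p (Set.mem_singleton p) k) hxk))
  · rw [hR.2.eq_one_of_pow hp hx hxk]; exact Subgroup.one_mem _

/-- This is the injector property at `N`. The `p`-part of `U` is shown to lie in `pCent F p ⊓ N`,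
where the smaller group `relCore {p} V ⊓ N` is already Sylow. -/
theorem le_of_inf_subnormal_le (hF : IsSelfCentralizing π F) (hFV : F ≤ V)
    (hV : IsMaximalIn (nilpotentPiGroups π) V) {N U : Subgroup G} (hN : N.IsSubnormal)
    (hU : nilpotentPiGroups π U) (hUN : U ≤ N) (hVU : V ⊓ N ≤ U) : U ≤ V := by
  have := hF.normal
  refine le_of_forall_prime_pow fun p x hx k hxk => ?_
  by_cases hp : p ∈ π; swap
  · rw [hU.2.eq_one_of_pow hp hx hxk]; exact Subgroup.one_mem _
  have hS := (hF.isSylowIn_relCore hFV hV hp).inf_subnormal hN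
  have hUle : relCore {p} U ≤ pCent F p := by
    intro y hy
    obtain ⟨m, hm, hym⟩ := isPiGroup_subgroup_iff.1 isPiGroup_relCore y hy
    have hA := relCore_normal (σ := {p}ᶜ) (W := F)
    -- The part of `relCore {p}ᶜ F` inside `N` lies in `V ⊓ N ≤ U`, where it commutes with the
    -- `p`-part of the nilpotent group `U`; coprime action extends this to all of `relCore {p}ᶜ F`.
    refine mem_pCent.2 (commute_of_commute_inf_subnormal isPiGroup_relCore hN
      (hUN (relRadical_le U hy)) hm hym fun z hz => ?_)
    have hzU : z ∈ U := hVU ⟨hFV (relRadical_le F hz.1), hz.2⟩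
    obtain ⟨n, hn, hzn⟩ := isPiGroup_subgroup_iff.1 isPiGroup_relCore z hz.1
    exact relCore_commute disjoint_compl_right hy (mem_relCore hU.1 hzU hn hzn)
  have hle : relCore {p} V ⊓ N ≤ relCore {p} U :=
    le_relCore hU.1 (le_trans (inf_le_inf_right N (relRadical_le V)) hVU)
      (isPiGroup_relCore.to_le inf_le_left)
  have heq := hS.eq_of_le isPiGroup_relCore
    (le_inf hUle ((relRadical_le U).trans hUN)) hle
  have hxU : x ∈ relCore {p} U := mem_relCore hU.1 hx (.prime_pow p (Set.mem_singleton p) k) hxk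
  rw [heq] at hxU
  exact relRadical_le V hxU.1

end IsSelfCentralizing

end Core

/-! ### `π`-soluble groups -/

section PiSoluble

variable {π σ : Set Nat.Primes} {G : Type u} [Group G] [Finite G]

/-- The sets of primes allowed for the factors of a series of a `π`-soluble group. -/
def IsFactorType (π σ : Set Nat.Primes) : Prop :=
  (∃ p ∈ π, σ = {p}) ∨ σ = πᶜ

/-- `π`-solubility, with the conditions on the factors expressed by elements. -/
theorem piSolubleGroups_iff : piSolubleGroups π G ↔
    ∃ (m : ℕ) (S : ℕ → Subgroup G), S 0 = ⊥ ∧ S m = ⊤ ∧ ∀ i < m, S i ≤ S (i + 1) ∧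
      S (i + 1) ≤ Subgroup.normalizer (S i : Set G) ∧ ∃ σ, IsFactorType π σ ∧
        ∀ x ∈ S (i + 1), ∃ n, IsPiNat σ n ∧ x ^ n ∈ S i := by
  refine exists_congr fun m => exists_congr fun S => and_congr_right fun _ => and_congr_right
    fun _ => forall₂_congr fun i _ => and_congr_right fun hle => ?_
  rw [exists_prop_congr (p' := S (i + 1) ≤ Subgroup.normalizer (S i : Set G))
    (q' := fun h => ∃ σ, IsFactorType π σ ∧
        ∀ x ∈ S (i + 1), ∃ n, IsPiNat σ n ∧ x ^ n ∈ S i) ?_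
    (Subgroup.normal_subgroupOf_iff_le_normalizer hle)]
  · exact exists_prop
  intro hn
  have key : ∀ σ, IsPiGroup σ (S (i + 1) ⧸ (S i).subgroupOf (S (i + 1))) ↔
      ∀ x ∈ S (i + 1), ∃ n, IsPiNat σ n ∧ x ^ n ∈ S i := fun σ => by
    rw [isPiGroup_quotient_iff, Subtype.forall]; rfl
  simp only [← isPiGroup_singleton_iff, key]
  constructor
  · rintro (⟨p, hp, h⟩ | h)
    · exact ⟨{p}, .inl ⟨p, hp, rfl⟩, h⟩
    · exact ⟨πᶜ, .inr rfl, h⟩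
  · rintro ⟨σ, ⟨p, hp, rfl⟩ | rfl, h⟩
    · exact .inl ⟨p, hp, h⟩
    · exact .inr h

theorem piSolubleGroups_of_surjective {H : Type u} [Group H] [Finite H] (f : G →* H)
    (hf : Function.Surjective f) (h : piSolubleGroups π G) : piSolubleGroups π H := by
  obtain ⟨m, S, h0, hm, h⟩ := piSolubleGroups_iff.1 h
  refine piSolubleGroups_iff.2 ⟨m, fun i => (S i).map f, by simp [h0], ?_, fun i hi => ?_⟩
  · simp only [hm]; exact Subgroup.map_top_of_surjective f hf
  obtain ⟨hle, hn, σ, hσ, hx⟩ := h i hi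
  refine ⟨Subgroup.map_mono hle, (Subgroup.map_mono hn).trans (Subgroup.le_normalizer_map f),
    σ, hσ, ?_⟩
  rintro _ ⟨x, hxS, rfl⟩
  obtain ⟨n, hn, hxn⟩ := hx x hxS
  exact ⟨n, hn, x ^ n, hxn, map_pow f x n⟩

theorem piSolubleGroups_of_injective {H : Type u} [Group H] [Finite H] (f : H →* G)
    (hf : Function.Injective f) (h : piSolubleGroups π G) : piSolubleGroups π H := by
  obtain ⟨m, S, h0, hm, h⟩ := piSolubleGroups_iff.1 h
  refine piSolubleGroups_iff.2 ⟨m, fun i => (S i).comap f, ?_, by simp [hm], fun i hi => ?_⟩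
  · simp only [h0]; exact (MonoidHom.ker_eq_bot_iff f).2 hf
  obtain ⟨hle, hn, σ, hσ, hx⟩ := h i hi
  refine ⟨Subgroup.comap_mono hle, (Subgroup.comap_mono hn).trans (Subgroup.le_normalizer_comap f),
    σ, hσ, fun x hxS => ?_⟩
  obtain ⟨n, hn, hxn⟩ := hx (f x) hxS
  exact ⟨n, hn, by rwa [Subgroup.mem_comap, map_pow]⟩

theorem subnormal_le_radical {F : GroupClass.{u}} (hF : IsFittingClass F) (hne : F.Nonempty)
    {N : Subgroup G} (hN : N.IsSubnormal) (h : F N) : N ≤ radical F G := by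
  have := relRadical_subnormal hF hne hN
  rw [relRadical_eq_self hF h] at this
  exact this ▸ inf_le_left

/-- All terms of the series are subnormal. The first nontrivial one is a `σ`-group for an allowed
`σ`, hence lies in the `σ`-core. -/
theorem exists_piCore_ne_bot [Nontrivial G] (h : piSolubleGroups π G) :
    ∃ σ, IsFactorType π σ ∧ piCore σ G ≠ ⊥ := by
  by_contra! hbot
  obtain ⟨m, S, h0, hm, h⟩ := piSolubleGroups_iff.1 h
  have hsub : ∀ j ≤ m, (S (m - j)).IsSubnormal := by
    intro j
    induction j with
    | zero => intro _; simp [hm]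
    | succ j ih =>
      intro hj
      obtain ⟨hle, hn, -⟩ := h (m - (j + 1)) (by omega)
      rw [show m - (j + 1) + 1 = m - j by omega] at hle hn
      exact .step _ _ hle (ih (by omega))
        ((Subgroup.normal_subgroupOf_iff_le_normalizer hle).2 hn)
  have hS : ∀ i ≤ m, S i = ⊥ := by
    intro i
    induction i with
    | zero => exact fun _ => h0
    | succ i ih =>
      intro hi
      obtain ⟨-, -, σ, hσ, hx⟩ := h i hi
      rw [ih (by omega)] at hx
      have hsn : (S (i + 1)).IsSubnormal := by
        have := hsub (m - (i + 1)) (by omega)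
        rwa [show m - (m - (i + 1)) = i + 1 by omega] at this
      rw [← le_bot_iff, ← hbot σ hσ]
      exact subnormal_le_radical (isFittingClass_piGroups σ) (nonempty_piGroups σ) hsn
        (isPiGroup_subgroup_iff.2 hx)
  exact bot_ne_top ((hS m le_rfl).symm.trans hm)

/-- In a `π`-soluble group without normal `π'`-subgroups, the largest normal nilpotent
`π`-subgroup contains its centralizer. -/
theorem isSelfCentralizing_radical (h : piSolubleGroups π G) (hcore : piCore πᶜ G = ⊥) :
    IsSelfCentralizing π (radical (nilpotentPiGroups π) G) := by
  refine ⟨inferInstance, radical_mem (isFittingClass_nilpotentPiGroups π)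
    (nonempty_nilpotentPiGroups π), ?_⟩
  let F := radical (nilpotentPiGroups π) G
  let C := Subgroup.centralizer (F : Set G)
  have hCn : C.Normal := inferInstanceAs (Subgroup.centralizer _).Normal
  let Z := radical (nilpotentPiGroups π) C
  have hZ : Z = F.subgroupOf C := radical_normal_eq (isFittingClass_nilpotentPiGroups π)
    (nonempty_nilpotentPiGroups π) C
  have hZc : ∀ z ∈ Z, ∀ x : C, x * z = z * x := by
    intro z hz x
    rw [hZ] at hz
    exact Subtype.ext (Subgroup.mem_centralizer_iff.1 x.2 z hz).symm
  change C ≤ F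
  rw [← Subgroup.subgroupOf_eq_top, ← hZ]
  by_contra hne
  have hnt : Nontrivial (C ⧸ Z) := QuotientGroup.nontrivial_iff.2 hne
  have hsol : piSolubleGroups π (C ⧸ Z) :=
    piSolubleGroups_of_surjective (QuotientGroup.mk' Z) (QuotientGroup.mk'_surjective Z)
      (piSolubleGroups_of_injective C.subtype C.subtype_injective h)
  obtain ⟨σ, hσ, hσne⟩ := exists_piCore_ne_bot hsol
  let D := (piCore σ (C ⧸ Z)).comap (QuotientGroup.mk' Z)
  have hDn : D.Normal := inferInstanceAs (Subgroup.comap _ _).Normal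
  have hDZ : ¬ D ≤ Z := by
    intro hle
    refine hσne ?_
    rw [← Subgroup.map_comap_eq_self_of_surjective (QuotientGroup.mk'_surjective Z)
      (piCore σ (C ⧸ Z)), Subgroup.map_eq_bot_iff, QuotientGroup.ker_mk']
    exact hle
  have hDpow : ∀ x ∈ D, ∃ n, IsPiNat σ n ∧ x ^ n ∈ Z := by
    intro x hx
    obtain ⟨n, hn, hxn⟩ := isPiGroup_subgroup_iff.1 isPiGroup_piCore _ hx
    exact ⟨n, hn, (QuotientGroup.eq_one_iff _).1 hxn⟩
  have hZπ : nilpotentPiGroups π Z := radical_mem (isFittingClass_nilpotentPiGroups π)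
    (nonempty_nilpotentPiGroups π)
  have hZD : Z ≤ D := QuotientGroup.le_comap_mk' _ _
  rcases hσ with ⟨p, hp, rfl⟩ | rfl
  -- Here `D` is a central extension of a `p`-group by `Z`, hence itself a nilpotent `π`-group, and
  -- so lies in the radical `Z` of `C`.
  · refine hDZ (le_radical hDn ⟨?_, ?_⟩)
    · let f : D →* piCore {p} (C ⧸ Z) :=
        (QuotientGroup.mk' Z).subgroupComap (piCore {p} (C ⧸ Z))
      have : Group.IsNilpotent (piCore {p} (C ⧸ Z)) :=
        isNilpotent_of_isPiGroup_singleton isPiGroup_piCore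
      refine Subgroup.isNilpotent_of_ker_le_center f fun x hx => ?_
      have hxZ : (x : C) ∈ Z := (QuotientGroup.eq_one_iff _).1 (congrArg Subtype.val hx)
      exact Subgroup.mem_center_iff.2 fun y => Subtype.ext (hZc _ hxZ y)
    · refine isPiGroup_subgroup_iff.2 fun x hx => ?_
      obtain ⟨n, hn, hxn⟩ := hDpow x hx
      obtain ⟨k, hk, hxk⟩ := isPiGroup_subgroup_iff.1 hZπ.2 _ hxn
      exact ⟨n * k, (hn.mono (Set.singleton_subset_iff.2 hp)).mul hk, by rw [pow_mul, hxk]⟩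
  -- By Schur–Zassenhaus, `Z` has a complement `B` in `D`, normal because `Z` is central. As a
  -- subnormal `π'`-subgroup of `G`, it lies in the trivial `π'`-core, which forces `D ≤ Z`.
  · have hcard : IsPiNat π (Nat.card (Z.subgroupOf D)) := by
      rw [Nat.card_congr (Subgroup.subgroupOfEquivOfLe hZD).toEquiv]
      exact isPiGroup_iff_card.1 hZπ.2
    have hindex : IsPiNat πᶜ (Z.subgroupOf D).index := by
      refine isPiGroup_iff_card.1 (isPiGroup_quotient_iff (N := Z.subgroupOf D).2 fun x => ?_)
      exact hDpow x x.2
    obtain ⟨B, hB⟩ := Subgroup.exists_right_complement'_of_coprime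
      (hcard.coprime hindex disjoint_compl_right)
    have hBn : B.Normal := by
      refine ⟨fun b hb g => ?_⟩
      obtain ⟨⟨z, b'⟩, hg⟩ := hB.2 g
      have hg : (z : D) * b' = g := hg
      have hz : ∀ y : D, (z : D) * y = y * z := fun y =>
        Subtype.ext (hZc _ z.2 y).symm
      rw [← hg, mul_inv_rev, mul_assoc, mul_assoc, hz]
      have := B.mul_mem (B.mul_mem b'.2 hb) (B.inv_mem b'.2)
      simpa [mul_assoc] using this
    have hBπ : IsPiGroup πᶜ B := by
      rw [isPiGroup_iff_card, ← hB.symm.index_eq_card]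
      exact hindex
    have hsn : ((B.map D.subtype).map C.subtype).IsSubnormal :=
      (hBn.isSubnormal.trans' hDn.isSubnormal).trans' hCn.isSubnormal
    have h1 := subnormal_le_radical (isFittingClass_piGroups πᶜ) (nonempty_piGroups πᶜ) hsn
      ((hBπ.map _).map _)
    rw [show radical (piGroups πᶜ) G = ⊥ from hcore, le_bot_iff,
      Subgroup.map_eq_bot_iff_of_injective _ C.subtype_injective,
      Subgroup.map_eq_bot_iff_of_injective _ D.subtype_injective] at h1
    rw [h1, Subgroup.isComplement'_bot_right, Subgroup.subgroupOf_eq_top] at hB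
    exact hDZ hB

/-- A `π`-soluble group has Hall `π`-subgroups. -/
theorem exists_isHallSubgroup (h : piSolubleGroups π G) :
    ∃ S : Subgroup G, IsHallSubgroup π S := by
  obtain ⟨n, hn⟩ : ∃ n, Nat.card G = n := ⟨_, rfl⟩
  induction n using Nat.strong_induction_on generalizing G with
  | _ n ih =>
  subst hn
  rcases subsingleton_or_nontrivial G with hG | hG
  · refine ⟨⊤, IsPiGroup.of_subsingleton, fun p hp => ?_⟩
    rw [Subgroup.index_top] at hp
    exact absurd (Nat.dvd_one.1 hp) p.2.ne_one
  obtain ⟨σ, hσ, hne⟩ := exists_piCore_ne_bot h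
  let M := piCore σ G
  have hM : IsPiGroup σ M := isPiGroup_piCore
  have hlt : Nat.card (G ⧸ M) < Nat.card G := by
    rw [Subgroup.card_eq_card_quotient_mul_card_subgroup M]
    exact lt_mul_of_one_lt_right Nat.card_pos (Subgroup.one_lt_card_iff_ne_bot M |>.2 hne)
  obtain ⟨S, hS, hSi⟩ := ih _ hlt (piSolubleGroups_of_surjective (QuotientGroup.mk' M)
    (QuotientGroup.mk'_surjective M) h) rfl
  let T := S.comap (QuotientGroup.mk' M)
  have hTi : T.index = S.index :=
    Subgroup.index_comap_of_surjective S (QuotientGroup.mk'_surjective M)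
  have hTpow : ∀ x ∈ T, ∃ n, IsPiNat π n ∧ x ^ n ∈ M := by
    intro x hx
    obtain ⟨n, hn, hxn⟩ := isPiGroup_subgroup_iff.1 hS _ hx
    exact ⟨n, hn, (QuotientGroup.eq_one_iff _).1 hxn⟩
  rcases hσ with ⟨p, hp, rfl⟩ | rfl
  · refine ⟨T, isPiGroup_subgroup_iff.2 fun x hx => ?_, by rwa [hTi]⟩
    obtain ⟨n, hn, hxn⟩ := hTpow x hx
    obtain ⟨k, hk, hxk⟩ := isPiGroup_subgroup_iff.1 hM _ hxn
    exact ⟨n * k, hn.mul (hk.mono (Set.singleton_subset_iff.2 hp)), by rw [pow_mul, hxk]⟩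
  -- Now `M` is a `π'`-group, and a Schur–Zassenhaus complement of `M` in `T` is a Hall subgroup of
  -- `G`.
  · have hMT : M ≤ T := QuotientGroup.le_comap_mk' _ _
    have hcard : IsPiNat πᶜ (Nat.card (M.subgroupOf T)) := by
      rw [Nat.card_congr (Subgroup.subgroupOfEquivOfLe hMT).toEquiv]
      exact isPiGroup_iff_card.1 hM
    have hindex : IsPiNat π (M.subgroupOf T).index :=
      isPiGroup_iff_card.1 ((isPiGroup_quotient_iff (N := M.subgroupOf T)).2 fun x => hTpow x x.2)
    obtain ⟨B, hB⟩ := Subgroup.exists_right_complement'_of_coprime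
      (hcard.coprime hindex disjoint_compl_left)
    have hBπ : IsPiGroup π B := by
      rw [isPiGroup_iff_card, ← hB.symm.index_eq_card]
      exact hindex
    refine ⟨B.map T.subtype, hBπ.map _, fun q hq => ?_⟩
    rw [← Subgroup.relIndex_mul_index (Subgroup.map_subtype_le B), q.2.dvd_mul, hTi] at hq
    rcases hq with hq | hq
    · rw [Subgroup.relIndex, Subgroup.subgroupOf,
        Subgroup.comap_map_eq_self_of_injective T.subtype_injective, hB.index_eq_card] at hq
      exact hcard.2 q hq
    · exact hSi q hq

end PiSoluble

/-! ### Injectors -/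

theorem comap_map_mk_eq {G : Type*} [Group G] {K V : Subgroup G} [K.Normal] (h : K ≤ V) :
    (V.map (QuotientGroup.mk' K)).comap (QuotientGroup.mk' K) = V := by
  rw [Subgroup.comap_map_eq, QuotientGroup.ker_mk', sup_eq_left.2 h]

section Injector

variable {π : Set Nat.Primes} {Y D : GroupClass.{u}} {G : Type u} [Group G] [Finite G]

theorem classMul_piGroups_self (σ : Set Nat.Primes) :
    classMul (piGroups.{u} σ) (piGroups σ) = piGroups σ := by
  funext A _ _
  refine propext ⟨fun h => isPiGroup_iff.2 fun x => ?_, fun h => ?_⟩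
  · obtain ⟨m, hm, hxm⟩ := isPiGroup_quotient_iff.1 h x
    obtain ⟨n, hn, hxn⟩ := isPiGroup_subgroup_iff.1 isPiGroup_piCore _ hxm
    exact ⟨m * n, hm.mul hn, by rw [pow_mul, hxn]⟩
  · exact IsPiGroup.of_surjective h (QuotientGroup.mk' _) (QuotientGroup.mk'_surjective _)

theorem nonempty_classMul_nilpotentPiGroups :
    (classMul Y (nilpotentPiGroups π)).Nonempty :=
  classMul_nonempty (isFittingClass_nilpotentPiGroups π) (nonempty_nilpotentPiGroups π)

/-- The preimage of the core is the radical for `classMul Y (piGroups σ)`, which is the `Y`-radical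
itself. -/
theorem piCore_quotient_radical_eq_bot (hY : IsFittingClass Y) (hne : Y.Nonempty)
    {σ : Set Nat.Primes} (h : classMul Y (piGroups σ) = Y) : piCore σ (G ⧸ radical Y G) = ⊥ := by
  have h1 := radical_classMul (G := G) hY hne (isFittingClass_piGroups σ) (nonempty_piGroups σ)
  rw [h] at h1
  rw [piCore, ← Subgroup.map_comap_eq_self_of_surjective
    (QuotientGroup.mk'_surjective (radical Y G)) (radical (piGroups σ) (G ⧸ radical Y G)), ← h1,
    Subgroup.map_eq_bot_iff, QuotientGroup.ker_mk']

theorem IsInjector.isMaximalIn (hD : IsFittingClass D) {V : Subgroup G} (hV : IsInjector D V) :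
    IsMaximalIn D V := by
  obtain ⟨h1, h2⟩ := hV ⊤ .top
  refine ⟨hD.iso _ _ (Subgroup.subgroupOfEquivOfLe le_top) h1, fun U hVU hU => ?_⟩
  have := h2 (U.subgroupOf ⊤) (Subgroup.comap_mono hVU)
    (hD.iso _ _ (Subgroup.subgroupOfEquivOfLe le_top).symm hU)
  simpa using Subgroup.subgroupOf_inj.1 this

theorem IsInjector.radical_le (hD : IsFittingClass D) (hne : D.Nonempty) {V : Subgroup G}
    (hV : IsInjector D V) : radical D G ≤ V := by
  obtain ⟨h1, h2⟩ := hV (radical D G) (radical_normal D G).isSubnormal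
  exact Subgroup.subgroupOf_eq_top.1
    (h2 ⊤ le_top (hD.iso _ _ Subgroup.topEquiv.symm (radical_mem hD hne))).symm

/-- The data for the theory of injectors of the class `classMul Y (nilpotentPiGroups π)`. -/
structure IsPiSaturated (π : Set Nat.Primes) (Y : GroupClass.{u}) : Prop where
  isFittingClass : IsFittingClass Y
  nonempty : Y.Nonempty
  classMul_eq : classMul Y (piGroups πᶜ) = Y

namespace IsPiSaturated

theorem piGroups_compl (π : Set Nat.Primes) : IsPiSaturated.{u} π (piGroups πᶜ) :=
  ⟨isFittingClass_piGroups _, nonempty_piGroups _, classMul_piGroups_self _⟩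

theorem classMul_piGroups {X : GroupClass.{u}} (hX : IsFittingClass X) (hne : X.Nonempty)
    (π : Set Nat.Primes) : IsPiSaturated π (classMul X (piGroups πᶜ)) :=
  ⟨isFittingClass_classMul hX hne (isFittingClass_piGroups _),
    classMul_nonempty (isFittingClass_piGroups _) (nonempty_piGroups _), by
    rw [classMul_assoc hX hne (isFittingClass_piGroups _) (nonempty_piGroups _)
      (isFittingClass_piGroups _), classMul_piGroups_self]⟩

variable (hY : IsPiSaturated π Y)

include hY

theorem isFittingClass_mul : IsFittingClass (classMul Y (nilpotentPiGroups π)) :=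
  isFittingClass_classMul hY.isFittingClass hY.nonempty (isFittingClass_nilpotentPiGroups π)

theorem radical_mul : radical (classMul Y (nilpotentPiGroups π)) G =
    (radical (nilpotentPiGroups π) (G ⧸ radical Y G)).comap (QuotientGroup.mk' (radical Y G)) :=
  radical_classMul hY.isFittingClass hY.nonempty (isFittingClass_nilpotentPiGroups π)
    (nonempty_nilpotentPiGroups π)

theorem radical_le_radical_mul : radical Y G ≤ radical (classMul Y (nilpotentPiGroups π)) G :=
  radical_le_radical_classMul hY.isFittingClass hY.nonempty (isFittingClass_nilpotentPiGroups π)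
    (nonempty_nilpotentPiGroups π)

theorem radical_le_map {V : Subgroup G}
    (hV : radical (classMul Y (nilpotentPiGroups π)) G ≤ V) :
    radical (nilpotentPiGroups π) (G ⧸ radical Y G) ≤
      V.map (QuotientGroup.mk' (radical Y G)) := by
  rw [hY.radical_mul] at hV
  rw [← Subgroup.map_comap_eq_self_of_surjective (QuotientGroup.mk'_surjective (radical Y G))
    (radical (nilpotentPiGroups π) (G ⧸ radical Y G))]
  exact Subgroup.map_mono hV

variable (hG : piSolubleGroups π (G ⧸ radical Y G))

include hG

theorem isSelfCentralizing :
    IsSelfCentralizing π (radical (nilpotentPiGroups π) (G ⧸ radical Y G)) :=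
  isSelfCentralizing_radical hG
    (piCore_quotient_radical_eq_bot hY.isFittingClass hY.nonempty hY.classMul_eq)

/-- All subgroups containing the radical for the product class have the same `Y`-radical. -/
theorem relRadical_eq {V : Subgroup G} (hV : radical (classMul Y (nilpotentPiGroups π)) G ≤ V) :
    relRadical Y V = radical Y G := by
  let K := radical Y G
  let F := radical (classMul Y (nilpotentPiGroups π)) G
  have hKF : K ≤ F := hY.radical_le_radical_mul
  have hK : relRadical Y K = relRadical Y V ⊓ K :=
    relRadical_normal_le hY.isFittingClass hY.nonempty (hKF.trans hV) inferInstance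
  rw [relRadical_eq_self hY.isFittingClass (radical_mem hY.isFittingClass hY.nonempty)] at hK
  have hF : relRadical Y F = relRadical Y V ⊓ F :=
    relRadical_normal_le hY.isFittingClass hY.nonempty hV inferInstance
  rw [relRadical_subnormal hY.isFittingClass hY.nonempty (radical_normal _ G).isSubnormal,
    inf_eq_left.2 hKF] at hF
  -- Commutators of the `Y`-radical of `V` with `F` lie in the intersection of the two, which is
  -- `K`. So this radical centralizes `F` modulo `K`, and the self-centralizing property applies.
  have hVF : relRadical Y V ≤ F := by
    intro x hx
    have hc : (x : G ⧸ K) ∈ Subgroup.centralizer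
        (radical (nilpotentPiGroups π) (G ⧸ K) : Set (G ⧸ K)) := by
      rw [Subgroup.mem_centralizer_iff]
      intro y hy
      obtain ⟨y, rfl⟩ := QuotientGroup.mk_surjective y
      have hyF : y ∈ F := by
        change y ∈ radical (classMul Y (nilpotentPiGroups π)) G
        rw [hY.radical_mul]; exact hy
      have hn := (Subgroup.normal_subgroupOf_iff (relRadical_le V)).1
        (relRadical_subgroupOf_normal (F := Y) V)
      have hz : (y * x)⁻¹ * (x * y) ∈ relRadical Y V ⊓ F := by
        constructor
        · have := (relRadical Y V).mul_mem ((relRadical Y V).inv_mem hx)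
            (hn x y⁻¹ hx (V.inv_mem (hV hyF)))
          simpa [mul_assoc] using this
        · have := F.mul_mem ((radical_normal _ G).conj_mem _ (F.inv_mem hyF) x⁻¹) hyF
          simpa [mul_assoc] using this
      rw [← hF] at hz
      exact QuotientGroup.eq.2 hz
    have := (hY.isSelfCentralizing hG).centralizer_le hc
    change x ∈ radical (classMul Y (nilpotentPiGroups π)) G
    rw [hY.radical_mul]; exact this
  rw [inf_eq_left.2 hVF] at hF
  exact hF.symm

theorem mul_iff {V : Subgroup G} (hV : radical (classMul Y (nilpotentPiGroups π)) G ≤ V) :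
    classMul Y (nilpotentPiGroups π) V ↔
      nilpotentPiGroups π (V.map (QuotientGroup.mk' (radical Y G))) :=
  classMul_subgroup_iff (isFittingClass_nilpotentPiGroups π) _ (by
    rw [hY.relRadical_eq hG hV, QuotientGroup.ker_mk',
      inf_eq_left.2 (hY.radical_le_radical_mul.trans hV)])

/-- Every overgroup of `V` also has `Y`-radical `radical Y G`, so testing maximality in `G` is the
same as testing it in the quotient. -/
theorem isMaximalIn_iff {V : Subgroup G}
    (hV : radical (classMul Y (nilpotentPiGroups π)) G ≤ V) :
    IsMaximalIn (classMul Y (nilpotentPiGroups π)) V ↔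
      IsMaximalIn (nilpotentPiGroups π) (V.map (QuotientGroup.mk' (radical Y G))) := by
  have hK : ∀ {U : Subgroup G}, V ≤ U → radical Y G ≤ U := fun hVU =>
    hY.radical_le_radical_mul.trans (hV.trans hVU)
  refine and_congr (hY.mul_iff hG hV) ⟨fun h U hVU hU => ?_, fun h U hVU hU => ?_⟩
  · rw [Subgroup.map_le_iff_le_comap] at hVU
    have hsurj := Subgroup.map_comap_eq_self_of_surjective
      (QuotientGroup.mk'_surjective (radical Y G)) U
    rw [← h _ hVU ((hY.mul_iff hG (hV.trans hVU)).2 (by rwa [hsurj])), hsurj]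
  · have := h _ (Subgroup.map_mono hVU) ((hY.mul_iff hG (hV.trans hVU)).1 hU)
    rw [← comap_map_mk_eq (hK hVU), this, comap_map_mk_eq (hK le_rfl)]

theorem isInjector {V : Subgroup G} (hV : radical (classMul Y (nilpotentPiGroups π)) G ≤ V)
    (hmax : IsMaximalIn (classMul Y (nilpotentPiGroups π)) V) :
    IsInjector (classMul Y (nilpotentPiGroups π)) V := by
  intro N hN
  refine ⟨?_, fun U hVU hU => le_antisymm ?_ hVU⟩
  · rw [← Subgroup.inf_subgroupOf_right]
    exact hY.isFittingClass_mul.iso _ _ (Subgroup.subgroupOfEquivOfLe inf_le_right).symm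
      (hY.isFittingClass_mul.subnormal_inf hmax.1 hN)
  let φ := QuotientGroup.mk' (radical Y G)
  have hVK : radical Y G ≤ V := hY.radical_le_radical_mul.trans hV
  -- The `Y`-quotient of `N` is thus its image in the quotient of `G`, so it is `π`-soluble and
  -- `relRadical_eq` applies inside `N` as well.
  have hker : (φ.comp N.subtype).ker = radical Y N := by
    rw [← relRadical_subgroupOf, relRadical_subnormal hY.isFittingClass hY.nonempty hN,
      Subgroup.inf_subgroupOf_right, ← MonoidHom.comap_ker, QuotientGroup.ker_mk']
    rfl
  have hNsol : piSolubleGroups π (N ⧸ radical Y N) := by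
    let e := quotientEquivRange (φ.comp N.subtype) (radical Y N) hker
    exact piSolubleGroups_of_injective
      ((Subgroup.subtype _).comp e.toMonoidHom)
      ((Subgroup.subtype_injective _).comp e.injective) hG
  have hUF : radical (classMul Y (nilpotentPiGroups π)) N ≤ U := by
    rw [← relRadical_subgroupOf,
      relRadical_subnormal hY.isFittingClass_mul nonempty_classMul_nilpotentPiGroups hN,
      Subgroup.inf_subgroupOf_right]
    exact (Subgroup.comap_mono hV).trans hVU
  have hUnil : nilpotentPiGroups π (U.map (φ.comp N.subtype)) := by
    refine (classMul_subgroup_iff (F := Y) (isFittingClass_nilpotentPiGroups π) _ ?_).1 hU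
    rw [hker, hY.relRadical_eq hNsol hUF, inf_eq_left]
    exact hY.radical_le_radical_mul.trans hUF
  have hle := (hY.isSelfCentralizing hG).le_of_inf_subnormal_le (hY.radical_le_map hV)
    ((hY.isMaximalIn_iff hG hV).1 hmax) (hN.map (QuotientGroup.mk'_surjective (radical Y G))) hUnil
    (by
      rintro _ ⟨x, -, rfl⟩
      exact ⟨x, x.2, rfl⟩)
    (by
      rintro _ ⟨⟨v, hv, rfl⟩, ⟨n, hn, hvn⟩⟩
      have hnV : n ∈ V := by
        rw [← comap_map_mk_eq hVK]
        exact ⟨v, hv, hvn.symm⟩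
      exact ⟨⟨n, hn⟩, hVU hnV, hvn⟩)
  intro x hx
  have : φ x ∈ V.map φ := hle ⟨x, hx, rfl⟩
  change (x : G) ∈ V
  rw [← comap_map_mk_eq hVK]
  exact this

theorem isInjector_iff {V : Subgroup G} : IsInjector (classMul Y (nilpotentPiGroups π)) V ↔
    radical (classMul Y (nilpotentPiGroups π)) G ≤ V ∧
      IsMaximalIn (classMul Y (nilpotentPiGroups π)) V :=
  ⟨fun h => ⟨h.radical_le hY.isFittingClass_mul nonempty_classMul_nilpotentPiGroups,
    h.isMaximalIn hY.isFittingClass_mul⟩, fun h => hY.isInjector hG h.1 h.2⟩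

theorem exists_isInjector : ∃ V : Subgroup G, IsInjector (classMul Y (nilpotentPiGroups π)) V := by
  classical
  choose P hP using fun p : Nat.Primes =>
    exists_isSylowIn p (pCent (radical (nilpotentPiGroups π) (G ⧸ radical Y G)) p)
  have h1 : ∀ p ∈ π, IsSylowIn p (pCent (radical (nilpotentPiGroups π) (G ⧸ radical Y G)) p)
      (if p ∈ π then P p else ⊥) := fun p hp => by rw [if_pos hp]; exact hP p
  have h2 : ∀ p ∉ π, (if p ∈ π then P p else ⊥) = ⊥ := fun p hp => if_neg hp
  have hF := hY.isSelfCentralizing hG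
  have hle : radical (classMul Y (nilpotentPiGroups π)) G ≤
      (⨆ p, if p ∈ π then P p else ⊥).comap (QuotientGroup.mk' (radical Y G)) := by
    rw [hY.radical_mul]
    exact Subgroup.comap_mono (hF.iSup_mem h1 h2).2
  refine ⟨_, hY.isInjector hG hle ((hY.isMaximalIn_iff hG hle).2 ?_)⟩
  rw [Subgroup.map_comap_eq_self_of_surjective (QuotientGroup.mk'_surjective _)]
  exact hF.isMaximalIn_iSup _ h1 h2

theorem isInjector_conj {V W : Subgroup G} (hV : IsInjector (classMul Y (nilpotentPiGroups π)) V)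
    (hW : IsInjector (classMul Y (nilpotentPiGroups π)) W) :
    ∃ g : G, V.map (MulAut.conj g).toMonoidHom = W := by
  rw [hY.isInjector_iff hG] at hV hW
  obtain ⟨g, hg⟩ := (hY.isSelfCentralizing hG).exists_conj (hY.radical_le_map hV.1)
    (hY.radical_le_map hW.1) ((hY.isMaximalIn_iff hG hV.1).1 hV.2)
    ((hY.isMaximalIn_iff hG hW.1).1 hW.2)
  obtain ⟨g, rfl⟩ := QuotientGroup.mk_surjective g
  have hKV := (hY.radical_le_radical_mul (G := G)).trans hV.1
  have hKW := (hY.radical_le_radical_mul (G := G)).trans hW.1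
  refine ⟨g, ?_⟩
  have hK : radical Y G ≤ V.map (MulAut.conj g).toMonoidHom := fun x hx =>
    ⟨g⁻¹ * x * g⁻¹⁻¹, hKV ((radical_normal Y G).conj_mem x hx g⁻¹), by simp [mul_assoc]⟩
  rw [← comap_map_mk_eq hK, ← comap_map_mk_eq hKW, ← hg, Subgroup.map_map, Subgroup.map_map]
  congr 2

end IsPiSaturated

end Injector

/-! ### The structure of the injectors -/

section Structure

variable {π : Set Nat.Primes} {G : Type u} [Group G] [Finite G]

theorem IsHallSubgroup.map_equiv {S : Subgroup G} (h : IsHallSubgroup π S) (e : G ≃* G) :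
    IsHallSubgroup π (S.map e.toMonoidHom) := by
  refine ⟨h.1.map _, fun p hp => h.2 p ?_⟩
  have : (S.map e.toMonoidHom).index = S.index := Subgroup.index_map_equiv S e
  rwa [this] at hp

/-- For `π`-groups, the classes of extensions of `π'`-groups by nilpotent `π`-groups and of
nilpotent `π`-groups coincide. -/
theorem classMul_compl_iff (hG : IsPiGroup π G) :
    classMul (piGroups πᶜ) (nilpotentPiGroups π) G ↔ nilpotentPiGroups π G :=
  classMul_iff_of_surjective (isFittingClass_nilpotentPiGroups π) (MonoidHom.id G)
    Function.surjective_id (by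
      rw [(hG.to_subgroup (radical (piGroups πᶜ) G)).eq_bot_of_compl isPiGroup_piCore]
      exact (MonoidHom.ker_eq_bot_iff _).2 Function.injective_id)

/-- The general theory is applied with the class of `π'`-groups as `Y`; on subgroups of a `π`-group
the product class is that of the nilpotent `π`-groups. -/
theorem isInjector_nilpotentPiGroups (hG : IsPiGroup π G) (hsol : piSolubleGroups π G)
    {V : Subgroup G} (hV : radical (nilpotentPiGroups π) G ≤ V)
    (hmax : IsMaximalIn (nilpotentPiGroups π) V) : IsInjector (nilpotentPiGroups π) V := by
  have hY := IsPiSaturated.piGroups_compl.{u} π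
  have hiff : ∀ {H : Type u} [Group H] [Finite H], IsPiGroup π H → ∀ U : Subgroup H,
      classMul (piGroups πᶜ) (nilpotentPiGroups π) U ↔ nilpotentPiGroups π U :=
    fun hH U => classMul_compl_iff (hH.to_subgroup U)
  have hmaxiff : ∀ {H : Type u} [Group H] [Finite H], IsPiGroup π H → ∀ U : Subgroup H,
      IsMaximalIn (classMul (piGroups πᶜ) (nilpotentPiGroups π)) U ↔
        IsMaximalIn (nilpotentPiGroups π) U := fun hH U =>
    and_congr (hiff hH U) (forall_congr' fun W => imp_congr_right fun _ =>
      imp_congr_left (hiff hH W))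
  have hrad : radical (classMul (piGroups πᶜ) (nilpotentPiGroups π)) G ≤ V :=
    (le_radical (radical_normal _ G) ((hiff hG _).1
      (radical_mem hY.isFittingClass_mul nonempty_classMul_nilpotentPiGroups))).trans hV
  have hinj := hY.isInjector (piSolubleGroups_of_surjective (QuotientGroup.mk' _)
    (QuotientGroup.mk'_surjective _) hsol) hrad ((hmaxiff hG V).2 hmax)
  exact fun K hK => (hmaxiff (hG.to_subgroup K) _).1 (hinj K hK)

/-- Let `V` be a maximal nilpotent `π`-subgroup containing the self-centralizing subgroup `F`. If a
`π`-soluble `π`-group `A` embeds into the group with an image containing `V`, then the preimage of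
`V` is an injector of `A`. -/
theorem isInjector_comap {A : Type u} [Group A] [Finite A] (hA : IsPiGroup π A)
    (hsol : piSolubleGroups π A) {F V : Subgroup G} (hF : IsSelfCentralizing π F) (hFV : F ≤ V)
    (hV : IsMaximalIn (nilpotentPiGroups π) V) (α : A →* G) (hα : Function.Injective α)
    (hVα : V ≤ α.range) : IsInjector (nilpotentPiGroups π) (V.comap α) := by
  have := hF.normal
  have hnil : ∀ U : Subgroup G, nilpotentPiGroups π U → nilpotentPiGroups π (U.comap α) := by
    intro U hU
    refine (isFittingClass_nilpotentPiGroups π).iso _ _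
      ((U.comap α).equivMapOfInjective α hα).symm ?_
    exact nilpotentPiGroups_to_le hU (Subgroup.map_comap_le α U)
  have hFA : IsSelfCentralizing π (F.comap α) := by
    refine ⟨inferInstance, hnil F hF.mem, fun x hx => hF.centralizer_le ?_⟩
    rw [Subgroup.mem_centralizer_iff] at hx ⊢
    intro y hy
    obtain ⟨y, rfl⟩ := hVα (hFV hy)
    rw [← map_mul, hx y hy, map_mul]
  have hmax : IsMaximalIn (nilpotentPiGroups π) (V.comap α) := by
    refine ⟨hnil V hV.1, fun U hVU hU => ?_⟩
    have hle : V ≤ U.map α := by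
      rw [← Subgroup.map_comap_eq_self hVα]
      exact Subgroup.map_mono hVU
    rw [← hV.2 _ hle (nilpotentPiGroups_map hU α), Subgroup.comap_map_eq_self_of_injective hα]
  refine isInjector_nilpotentPiGroups hA hsol ?_ hmax
  exact hFA.normal_le (Subgroup.comap_mono hFV) hmax
    (radical_mem (isFittingClass_nilpotentPiGroups π) (nonempty_nilpotentPiGroups π))
    (le_radical inferInstance hFA.mem)

/-- A maximal nilpotent `π`-subgroup over a self-centralizing one is, up to conjugacy, contained
in any given subgroup of `π'`-index. -/
theorem IsSelfCentralizing.exists_conj_le {F V T : Subgroup G} (hF : IsSelfCentralizing π F)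
    (hFV : F ≤ V) (hV : IsMaximalIn (nilpotentPiGroups π) V)
    (hT : ∀ p : Nat.Primes, (p : ℕ) ∣ T.index → p ∉ π) :
    ∃ g : G, V ≤ T.map (MulAut.conj g).toMonoidHom := by
  classical
  have := hF.normal
  choose P hP using fun p : Nat.Primes => exists_isSylowIn p (pCent F p ⊓ T)
  -- As `pCent F p` is normal, the index of its intersection with `T` divides the index of `T`. A
  -- Sylow `p`-subgroup of the intersection is therefore Sylow in `pCent F p`, and the resulting
  -- maximal subgroup lies in `T`.
  have h1 : ∀ p ∈ π, IsSylowIn p (pCent F p) (if p ∈ π then P p else ⊥) := by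
    intro p hp
    have hn := pCent_normal (F := F) (p := p)
    rw [if_pos hp]
    refine ⟨(hP p).le.trans inf_le_left, (hP p).isPiGroup, fun hd => ?_⟩
    rw [← Subgroup.relIndex_mul_relIndex _ _ _ (hP p).le inf_le_left, p.2.dvd_mul,
      Subgroup.inf_relIndex_left] at hd
    exact hd.elim (hP p).not_dvd fun hd =>
      hT p (hd.trans (relIndex_dvd_index_of_normal_right T (pCent F p))) hp
  have h2 : ∀ p ∉ π, (if p ∈ π then P p else ⊥) = ⊥ := fun p hp => if_neg hp
  obtain ⟨g, hg⟩ := hF.exists_conj (hF.iSup_mem h1 h2).2 hFV (hF.isMaximalIn_iSup _ h1 h2) hV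
  refine ⟨g, hg ▸ Subgroup.map_mono (iSup_le fun p => ?_)⟩
  split_ifs
  · exact (hP p).le.trans inf_le_right
  · exact bot_le

theorem exists_structure_of_isInjector {X : GroupClass.{u}} (hX : IsFittingClass X)
    (hne : X.Nonempty) (hG : classMul X (piSolubleGroups π) G) {V : Subgroup G}
    (hV : IsInjector (classMul (classMul X (piGroups πᶜ)) (nilpotentPiGroups π)) V) :
    ∃ L : Subgroup G, radical X G ≤ L ∧
      (∃ S : Subgroup (G ⧸ radical X G), IsHallSubgroup π S ∧
        L.map (QuotientGroup.mk' (radical X G)) ≤ S ∧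
        IsInjector (nilpotentPiGroups π)
          ((L.map (QuotientGroup.mk' (radical X G))).subgroupOf S)) ∧
      (V : Set G) = (radical (classMul X (piGroups πᶜ)) G : Set G) * (L : Set G) := by
  have hY := IsPiSaturated.classMul_piGroups hX hne π
  have hG : piSolubleGroups π (G ⧸ radical X G) := hG
  let R := radical X G
  let K := radical (classMul X (piGroups πᶜ)) G
  let ψ := QuotientGroup.mk' R
  let φ := QuotientGroup.mk' K
  have hRK : R ≤ K :=
    radical_le_radical_classMul hX hne (isFittingClass_piGroups _) (nonempty_piGroups _)
  let θ : G ⧸ R →* G ⧸ K := QuotientGroup.lift R φ fun x hx => (QuotientGroup.eq_one_iff x).2 (hRK hx)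
  have hθψ : ∀ x, θ (ψ x) = φ x := fun x => rfl
  have hθ : Function.Surjective θ := fun y =>
    have ⟨x, hx⟩ := QuotientGroup.mk'_surjective K y
    ⟨ψ x, hx⟩
  have hker : θ.ker = piCore πᶜ (G ⧸ R) := by
    ext x
    obtain ⟨x, rfl⟩ := QuotientGroup.mk'_surjective R x
    have h1 : θ (ψ x) = 1 ↔ x ∈ K := QuotientGroup.eq_one_iff x
    rw [MonoidHom.mem_ker, h1]
    change x ∈ radical (classMul X (piGroups πᶜ)) G ↔ _
    rw [radical_classMul hX hne (isFittingClass_piGroups _) (nonempty_piGroups _)]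
    rfl
  have hGK : piSolubleGroups π (G ⧸ K) := piSolubleGroups_of_surjective θ hθ hG
  obtain ⟨hFV, hVmax⟩ := (hY.isInjector_iff hGK).1 hV
  have hKV : K ≤ V := hY.radical_le_radical_mul.trans hFV
  have hF := hY.isSelfCentralizing hGK
  have hFV' := hY.radical_le_map hFV
  have hVmax' := (hY.isMaximalIn_iff hGK hFV).1 hVmax
  obtain ⟨S₀, hS₀⟩ := exists_isHallSubgroup hG
  obtain ⟨g, hg⟩ := hF.exists_conj_le (T := S₀.map θ) hFV' hVmax' fun p hp =>
    hS₀.2 p (hp.trans (Subgroup.index_map_dvd S₀ hθ))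
  -- The conjugating element is lifted along `θ`, so that the Hall subgroup can be replaced by a
  -- conjugate whose image covers that of `V`.
  obtain ⟨g, rfl⟩ := hθ g
  let S := S₀.map (MulAut.conj g).toMonoidHom
  have hS : IsHallSubgroup π S := hS₀.map_equiv (MulAut.conj g)
  have hVS : V.map φ ≤ S.map θ := by
    refine hg.trans ?_
    rintro _ ⟨_, ⟨s, hs, rfl⟩, rfl⟩
    exact ⟨g * s * g⁻¹, ⟨s, hs, rfl⟩, by simp⟩
  let L := V ⊓ S.comap ψ
  have hLS : L.map ψ ≤ S := by
    rw [Subgroup.map_le_iff_le_comap]; exact inf_le_right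
  refine ⟨L, le_inf (hRK.trans hKV) (QuotientGroup.le_comap_mk' _ _), ⟨S, hS, hLS, ?_⟩, ?_⟩
  · let α : S →* G ⧸ K := θ.comp S.subtype
    -- The kernel lies in a Hall `π`-subgroup and in the `π'`-core, which is the kernel of `θ`.
    have hα : Function.Injective α := by
      rw [← MonoidHom.ker_eq_bot_iff]
      have h1 : IsPiGroup πᶜ (α.ker.map S.subtype) := by
        refine isPiGroup_piCore.to_le (K := piCore πᶜ (G ⧸ R)) ?_
        rw [← hker]
        rintro _ ⟨x, hx, rfl⟩
        exact hx
      exact (hS.1.to_subgroup _).eq_bot_of_compl ((isFittingClass_piGroups.{u} πᶜ).iso _ _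
        (α.ker.equivMapOfInjective _ S.subtype_injective).symm h1)
    have hrange : V.map φ ≤ α.range := by
      rwa [MonoidHom.range_comp, Subgroup.range_subtype]
    have heq : (L.map ψ).subgroupOf S = (V.map φ).comap α := by
      ext ⟨x, hx⟩
      constructor
      · rintro ⟨y, hy, hyx⟩
        exact ⟨y, hy.1, congrArg θ hyx⟩
      · intro hxV
        obtain ⟨y, rfl⟩ := QuotientGroup.mk'_surjective R x
        have hyV : y ∈ V := by
          rw [← comap_map_mk_eq hKV]; exact hxV
        exact ⟨y, ⟨hyV, hx⟩, rfl⟩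
    rw [heq]
    exact isInjector_comap hS.1 (piSolubleGroups_of_injective S.subtype S.subtype_injective hG)
      hF hFV' hVmax' α hα hrange
  · ext v
    rw [Set.mem_mul]
    constructor
    · intro hv
      -- Modulo `K`, the element `v` agrees with a representative of an element of `S`. That
      -- representative lies in `V` because `K ≤ V`, hence in `L`.
      obtain ⟨s, hs, hsv⟩ := hVS ⟨v, hv, rfl⟩
      obtain ⟨x, rfl⟩ := QuotientGroup.mk'_surjective R s
      have hxv : v * x⁻¹ ∈ K := by
        refine (QuotientGroup.eq_one_iff _).1 ?_
        change φ (v * x⁻¹) = 1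
        rw [map_mul, map_inv, ← hsv]
        exact mul_inv_cancel (φ x)
      refine ⟨v * x⁻¹, hxv, x, ⟨?_, hs⟩, by simp⟩
      have := V.mul_mem (V.inv_mem (hKV hxv)) hv
      simpa using this
    · rintro ⟨k, hk, l, hl, rfl⟩
      exact V.mul_mem (hKV hk) hl.1

end Structure

theorem theorem1p5 (h : HFunction.{u}) (X : GroupClass.{u}) (hX : IsFittingClass X)
    (hXne : X.Nonempty) (hinv : ∀ p ∈ h.supp, h.toFun p = X)
    (G : Type u) [Group G] [Finite G] :
    -- in particular, the result applies to every `π`-soluble group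
    (piSolubleGroups h.supp G → classMul X (piSolubleGroups h.supp) G) ∧
    (classMul X (piSolubleGroups h.supp) G →
      -- existence and conjugacy of injectors
      ((∃ V : Subgroup G, IsInjector (hartleyClass h) V) ∧
        ∀ V W : Subgroup G, IsInjector (hartleyClass h) V → IsInjector (hartleyClass h) W →
          ∃ g : G, V.map (MulAut.conj g).toMonoidHom = W) ∧
      -- structure of the injectors
      ∀ V : Subgroup G, IsInjector (hartleyClass h) V →
        ∃ L : Subgroup G, radical X G ≤ L ∧
          (∃ S : Subgroup (G ⧸ radical X G), IsHallSubgroup h.supp S ∧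
            L.map (QuotientGroup.mk' (radical X G)) ≤ S ∧
            IsInjector (nilpotentPiGroups h.supp)
              ((L.map (QuotientGroup.mk' (radical X G))).subgroupOf S)) ∧
          (V : Set G) = (radical (classMul X (piGroups h.suppᶜ)) G : Set G) * (L : Set G)) := by
  rw [hartleyClass_eq h hX hXne hinv]
  refine ⟨piSolubleGroups_of_surjective (QuotientGroup.mk' _) (QuotientGroup.mk'_surjective _),
    fun hG => ?_⟩
  have hY := IsPiSaturated.classMul_piGroups hX hXne h.supp
  have hRK : radical X G ≤ radical (classMul X (piGroups h.suppᶜ)) G :=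
    radical_le_radical_classMul hX hXne (isFittingClass_piGroups _) (nonempty_piGroups _)
  have hGK : piSolubleGroups h.supp (G ⧸ radical (classMul X (piGroups h.suppᶜ)) G) :=
    piSolubleGroups_of_surjective
      (QuotientGroup.map (radical X G) (radical (classMul X (piGroups h.suppᶜ)) G)
        (MonoidHom.id G) hRK)
      (QuotientGroup.map_surjective_of_surjective _ _ _ (QuotientGroup.mk_surjective) hRK) hG
  exact ⟨⟨hY.exists_isInjector hGK, fun V W => hY.isInjector_conj hGK⟩,
    fun V hV => exists_structure_of_isInjector hX hXne hG hV⟩
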